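/- Let $M\cong\mathbb Z^3$, $N=\mathrm{Hom}(M,\mathbb Z)$, and let $v_1,\dots,v_k\in N$ be the distinct primitive generators of the rays of a full-dimensional strongly convex integral polyhedral cone $\sigma=\mathbb R_+v_1+\dots+\mathbb R_+v_k\subset N\otimes\mathbb R$. Let $R=\mathbb C[\sigma^\vee\cap M]$, a positively graded ring of Krull dimension $3$, and let $R^+$ be the ideal generated by the monomials of nonzero degree. For $b\in\mathbb Z^k$ let $T(b)\subset\mathbb C[M]$ be the $R$-module spanned over $\mathbb C$ by $\{m\in M:\langle m,v_i\rangle\ge b_i\text{ for all }i\}$. An $R$-module $T$ is called Cohen–Macaulay if $\mathrm{Ext}^i_R(R/R^+,T)=0$ for all $i<\dim R$. An $R$-algebra $A$ is called a noncommutative crepant resolution (NCCR) of $R$ if $A\cong\mathrm{End}_R(T)$ for a finitely generated reflexive $R$-module $T$ and all simple $A$-modules have the same projective dimension. Let $\phi:\mathbb Z^k\to N$, $b\mapsto\sum_i b_iv_i$, let $\phi^T:M\to\mathbb Z^k$, $m\mapsto(\langle m,v_i\rangle)_i$, and let $\kappa(b)=(\phi\phi^T\otimes\mathbb R)^{-1}\phi(b)\in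 M\otimes\mathbb R$ and $\bar\kappa(b)$ be its class in the $3$-torus $(M\otimes\mathbb R)/M$. (1) If $b\in\mathbb Z^k$ satisfies $\sum_i b_iv_i=0$ and $T(b)$ is Cohen–Macaulay, then all $b_i$ are zero. (2) If $b^1,\dots,b^\ell\in\mathbb Z^k$ are such that $\mathrm{End}_R\big(\bigoplus_j T(b^j)\big)$ is an NCCR of $R$, then $\bar\kappa(b^i)=\bar\kappa(b^j)$ implies $T(b^i)\cong T(b^j)$ as $R$-modules. In particular, if the $T(b^j)$ are pairwise non-isomorphic, then the points $\bar\kappa(b^1),\dots,\bar\kappa(b^\ell)$ of the torus are pairwise distinct. -/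

import Mathlib

open scoped TensorProduct Pointwise

universe u

noncomputable section

namespace ToricNCCR

/-! ### Homological notions -/

/-- Let `R` be a positively graded ring with irrelevant ideal `I = R⁺`, so that `R ⧸ I` is the base
field. An `R`-module `T` is Cohen-Macaulay if `Ext^i_R(R ⧸ I, T) = 0` for every `i` smaller than
the Krull dimension of `R`. -/
def IsCohenMacaulay (R : Type u) [CommRing R] (I : Ideal R)
    (T : Type u) [AddCommGroup T] [Module R T] : Prop :=
  ∀ i : ℕ, (i : WithBot ℕ∞) < ringKrullDim R →
    Subsingleton (CategoryTheory.Abelian.Ext (ModuleCat.of R (R ⧸ I)) (ModuleCat.of R T) i)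

/-- A ring is homologically homogeneous if all its simple modules have the same projective
dimension. -/
def IsHomologicallyHomogeneous (A : Type u) [Ring A] : Prop :=
  ∀ (S S' : ModuleCat.{u} A), IsSimpleModule A S → IsSimpleModule A S' →
    CategoryTheory.projectiveDimension S = CategoryTheory.projectiveDimension S'

/-- An `R`-algebra `A` is a noncommutative crepant resolution of `R` if it is isomorphic to the
endomorphism algebra of a finitely generated reflexive `R`-module, and is homologically
homogeneous. -/
def IsNCCR (R : Type u) [CommRing R] (A : Type u) [Ring A] [Algebra R A] : Prop :=
  (∃ (T : Type u) (_ : AddCommGroup T) (_ : Module R T),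
    Module.Finite R T ∧ Module.IsReflexive R T ∧ Nonempty (A ≃ₐ[R] Module.End R T)) ∧
  IsHomologicallyHomogeneous A

/-! ### Cones

`M` is a lattice, `N = Module.Dual ℤ M`, and `M ⊗ ℝ`, `N ⊗ ℝ` are written with the scalars on the
left. The vectors `v i` are the given elements of `N`. -/

section Cones

variable (M : Type u) [AddCommGroup M]

/-- The pairing between `N ⊗ ℝ` and `M ⊗ ℝ`. -/
def pairing : (ℝ ⊗[ℤ] Module.Dual ℤ M) →ₗ[ℝ] (ℝ ⊗[ℤ] M) →ₗ[ℝ] ℝ :=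
  (Module.Dual.baseChange (R := ℤ) (V := M) ℝ).liftBaseChange ℝ

@[simp] lemma pairing_tmul (r s : ℝ) (f : Module.Dual ℤ M) (m : M) :
    pairing M (r ⊗ₜ f) (s ⊗ₜ m) = r * s * (f m : ℝ) := by
  simp only [pairing, LinearMap.liftBaseChange_tmul, LinearMap.smul_apply,
    Module.Dual.baseChange_apply_tmul, smul_eq_mul]
  rw [zsmul_eq_mul]
  ring

variable {M} {k : ℕ} (v : Fin k → Module.Dual ℤ M)

/-- The cone `σ = ℝ₊ v₁ + ⋯ + ℝ₊ vₖ` in `N ⊗ ℝ`. -/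
def cone : PointedCone ℝ (ℝ ⊗[ℤ] Module.Dual ℤ M) :=
  PointedCone.hull ℝ (Set.range fun i => (1 : ℝ) ⊗ₜ[ℤ] v i)

/-- The dual cone `σ^∨` in `M ⊗ ℝ`. -/
def dualCone : PointedCone ℝ (ℝ ⊗[ℤ] M) :=
  PointedCone.dual (pairing M) (cone v : Set (ℝ ⊗[ℤ] Module.Dual ℤ M))

/-- `τ` is a face of the cone `σ`: there is `m ∈ σ^∨` with `τ = {x ∈ σ | ⟨m, x⟩ = 0}`. -/
def IsConeFace (τ : PointedCone ℝ (ℝ ⊗[ℤ] Module.Dual ℤ M)) : Prop :=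
  ∃ m ∈ dualCone v, ∀ x, x ∈ τ ↔ x ∈ cone v ∧ pairing M x m = 0

/-- The `v i` are the distinct primitive generators of the rays of a full-dimensional integral
polyhedral cone. (As soon as `0 < k`, the condition that the `ℝ₊ v i` are faces forces the cone to
be strongly convex.) -/
structure IsRaySystem : Prop where
  injective : Function.Injective v
  primitive : ∀ (i : Fin k) (n : ℤ) (w : Module.Dual ℤ M), v i = n • w → IsUnit n
  isFace : ∀ i, IsConeFace v (PointedCone.hull ℝ {(1 : ℝ) ⊗ₜ[ℤ] v i})
  span_eq_top : Submodule.span ℝ (Set.range fun i => (1 : ℝ) ⊗ₜ[ℤ] v i) = ⊤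

/-! ### The toric ring and its reflexive modules of rank one -/

lemma one_tmul_mem_dualCone {m : M} :
    (1 : ℝ) ⊗ₜ[ℤ] m ∈ dualCone v ↔ ∀ i, 0 ≤ v i m := by
  constructor
  · intro h i
    have := h (PointedCone.subset_hull (R := ℝ) (Set.mem_range_self i))
    simpa using this
  · intro h x hx
    induction hx using Submodule.span_induction with
    | mem x hx => obtain ⟨i, rfl⟩ := hx; simpa using h i
    | zero => simp
    | add x y _ _ hx hy => rw [map_add, LinearMap.add_apply]; exact add_nonneg hx hy
    | smul a x _ hx =>
      rw [← Nonneg.coe_smul, map_smul, LinearMap.smul_apply]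
      exact mul_nonneg a.2 hx

variable (M) in
/-- The group algebra `ℂ[M]`. -/
def LaurentRing : Type u := AddMonoidAlgebra ℂ M

instance : CommRing (LaurentRing M) := inferInstanceAs (CommRing (AddMonoidAlgebra ℂ M))

instance : Algebra ℂ (LaurentRing M) := inferInstanceAs (Algebra ℂ (AddMonoidAlgebra ℂ M))

/-- The set of degrees `m ∈ M` of the monomials that occur in an element of `ℂ[M]`. -/
def LaurentRing.supp (f : LaurentRing M) : Finset M := AddMonoidAlgebra.coeff f |>.support

/-- The monomial of degree `m` in `ℂ[M]`. -/
def LaurentRing.monomial (m : M) : LaurentRing M := AddMonoidAlgebra.single m (1 : ℂ)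

lemma LaurentRing.mem_supp_add {f g : LaurentRing M} {m : M} (h : m ∈ (f + g).supp) :
    m ∈ f.supp ∨ m ∈ g.supp := by
  classical
  exact Finset.mem_union.1 (Finsupp.support_add h)

lemma LaurentRing.mem_supp_mul {f g : LaurentRing M} {m : M} (h : m ∈ (f * g).supp) :
    ∃ a ∈ f.supp, ∃ b ∈ g.supp, a + b = m := by
  classical
  exact Finset.mem_add.1 (AddMonoidAlgebra.support_coeff_mul_subset _ _ h)

lemma LaurentRing.supp_zero : (0 : LaurentRing M).supp = ∅ := Finsupp.support_zero

lemma LaurentRing.eq_zero_of_mem_supp_algebraMap {r : ℂ} {m : M}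
    (h : m ∈ (algebraMap ℂ (LaurentRing M) r).supp) : m = 0 := by
  by_contra hm
  have h' : m ∈ (algebraMap ℂ (AddMonoidAlgebra ℂ M) r).coeff.support := h
  simp [AddMonoidAlgebra.coe_algebraMap, Ne.symm hm] at h'

/-- The toric ring `R = ℂ[σ^∨ ∩ M]`, as a subalgebra of `ℂ[M]`. -/
def toricRing : Subalgebra ℂ (LaurentRing M) where
  carrier := {f | ∀ m ∈ f.supp, (1 : ℝ) ⊗ₜ[ℤ] m ∈ dualCone v}
  mul_mem' {f g} hf hg := by
    intro m hm
    obtain ⟨a, ha, b, hb, rfl⟩ := LaurentRing.mem_supp_mul hm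
    rw [TensorProduct.tmul_add]
    exact add_mem (hf a ha) (hg b hb)
  add_mem' {f g} hf hg := by
    intro m hm
    rcases LaurentRing.mem_supp_add hm with h | h
    · exact hf m h
    · exact hg m h
  algebraMap_mem' r := by
    intro m hm
    have := LaurentRing.eq_zero_of_mem_supp_algebraMap hm
    subst this
    simp

/-- The ideal `R⁺` of the positively graded ring `R = ℂ[σ^∨ ∩ M]`, generated by the monomials
of nonzero degree. -/
def irrelevantIdeal : Ideal (toricRing v) :=
  Ideal.span {f | ∃ m : M, m ≠ 0 ∧ (f : LaurentRing M) = LaurentRing.monomial m}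

/-- The `R`-module `T(b) ⊆ ℂ[M]` spanned over `ℂ` by the monomials of degree
`m` with `⟨m, v i⟩ ≥ b i` for all `i`. -/
def rankOne (b : Fin k → ℤ) : Submodule (toricRing v) (LaurentRing M) where
  carrier := {f | ∀ m ∈ f.supp, ∀ i, b i ≤ v i m}
  add_mem' {f g} hf hg := by
    intro m hm
    rcases LaurentRing.mem_supp_add hm with h | h
    · exact hf m h
    · exact hg m h
  zero_mem' := by simp [LaurentRing.supp_zero]
  smul_mem' r f hf := by
    intro m hm i
    obtain ⟨x, hx, y, hy, rfl⟩ := LaurentRing.mem_supp_mul hm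
    have h1 := (one_tmul_mem_dualCone v).1 (r.2 x hx) i
    have h2 := hf y hy i
    rw [map_add]
    omega

/-- The finite direct sum `T(b¹) ⊕ ⋯ ⊕ T(bˡ)`. -/
abbrev rankOneSum {l : ℕ} (b : Fin l → Fin k → ℤ) : Type u := ∀ j, rankOne v (b j)

/-! ### The maps to the torus -/

/-- `φ : ℤ^k → N`, `b ↦ ∑ b_i v_i`. -/
def phi : (Fin k → ℤ) →ₗ[ℤ] Module.Dual ℤ M := Fintype.linearCombination ℤ v

/-- `φᵀ : M → ℤ^k`, `m ↦ (⟨m, v_i⟩)_i`. -/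
def phiT : M →ₗ[ℤ] (Fin k → ℤ) := LinearMap.pi v

/-- `φφᵀ ⊗ ℝ : M ⊗ ℝ → N ⊗ ℝ`. -/
def phiPhiT : (ℝ ⊗[ℤ] M) →ₗ[ℝ] (ℝ ⊗[ℤ] Module.Dual ℤ M) := (phi v ∘ₗ phiT v).baseChange ℝ

lemma phiPhiT_apply (x : ℝ ⊗[ℤ] M) :
    phiPhiT v x = ∑ i, pairing M (1 ⊗ₜ v i) x • ((1 : ℝ) ⊗ₜ[ℤ] v i) := by
  induction x with
  | zero => simp
  | add x y hx hy => simp [hx, hy, add_smul, Finset.sum_add_distrib]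
  | tmul r m =>
    simp only [phiPhiT, LinearMap.baseChange_tmul, LinearMap.comp_apply, phi, phiT,
      Fintype.linearCombination_apply, LinearMap.pi_apply, TensorProduct.tmul_sum]
    refine Finset.sum_congr rfl fun i _ => ?_
    rw [pairing_tmul, TensorProduct.smul_tmul', TensorProduct.tmul_smul,
      TensorProduct.smul_tmul']
    congr 1
    simp [mul_comm]

variable [Module.Free ℤ M]

lemma eq_zero_of_pairing_eq_zero {x : ℝ ⊗[ℤ] M} (h : ∀ y, pairing M y x = 0) : x = 0 := by
  let B := Module.Free.chooseBasis ℤ M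
  apply (B.baseChange ℝ).repr.injective
  ext j
  have key : ∀ z : ℝ ⊗[ℤ] M, (B.baseChange ℝ).repr z j = pairing M (1 ⊗ₜ B.coord j) z := by
    intro z
    induction z with
    | zero => simp
    | add a b ha hb => simp [ha, hb]
    | tmul r m => simp [mul_comm]
  rw [key, h]
  simp

variable [Module.Finite ℤ M]

variable {v} in
lemma phiPhiT_bijective (hv : IsRaySystem v) : Function.Bijective (phiPhiT v) := by
  have hinj : Function.Injective (phiPhiT v) := by
    rw [← LinearMap.ker_eq_bot, LinearMap.ker_eq_bot']
    intro x hx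
    have h0 : ∑ i, pairing M (1 ⊗ₜ v i) x * pairing M (1 ⊗ₜ v i) x = 0 := by
      have := congrArg (fun y => pairing M y x) hx
      simpa [phiPhiT_apply] using this
    have h1 : ∀ i, pairing M (1 ⊗ₜ v i) x = 0 := fun i => by
      have := (Finset.sum_eq_zero_iff_of_nonneg (fun i _ => mul_self_nonneg _)).1 h0 i
        (Finset.mem_univ i)
      simpa using this
    apply eq_zero_of_pairing_eq_zero
    intro y
    have hy : y ∈ Submodule.span ℝ (Set.range fun i => (1 : ℝ) ⊗ₜ[ℤ] v i) := by
      rw [hv.span_eq_top]; trivial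
    induction hy using Submodule.span_induction with
    | mem y hy => obtain ⟨i, rfl⟩ := hy; exact h1 i
    | zero => simp
    | add a b _ _ ha hb => simp [ha, hb]
    | smul a y _ hy => simp [hy]
  have hrank : Module.finrank ℝ (ℝ ⊗[ℤ] M) = Module.finrank ℝ (ℝ ⊗[ℤ] Module.Dual ℤ M) := by
    rw [Module.finrank_baseChange, Module.finrank_baseChange]
    exact (LinearEquiv.finrank_eq (Module.Free.chooseBasis ℤ M).toDualEquiv)
  exact ⟨hinj, (LinearMap.injective_iff_surjective_of_finrank_eq_finrank hrank).1 hinj⟩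

variable {v}

/-- `κ(b) = (φφᵀ ⊗ ℝ)⁻¹ (φ(b))`. -/
def kappa (hv : IsRaySystem v) (b : Fin k → ℤ) : ℝ ⊗[ℤ] M :=
  (LinearEquiv.ofBijective (phiPhiT v) (phiPhiT_bijective hv)).symm (1 ⊗ₜ phi v b)

variable (M) in
/-- The torus `(M ⊗ ℝ) / M`. -/
abbrev Torus : Type u := (ℝ ⊗[ℤ] M) ⧸ LinearMap.range (TensorProduct.mk ℤ ℝ M 1)

/-- `κ̄ : ℤ^k → (M ⊗ ℝ) / M`. -/
def kappaBar (hv : IsRaySystem v) (b : Fin k → ℤ) : Torus M :=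
  Submodule.Quotient.mk (kappa hv b)

end Cones

end ToricNCCR

end

set_option linter.unusedSectionVars false

noncomputable section

namespace ToricNCCR

/-! ### Lattice points of the dual cone -/

section Lattice

variable {M : Type u} [AddCommGroup M] [Module.Free ℤ M] [Module.Finite ℤ M]

/-! The key fact is that T(c) is not Cohen–Macaulay when `c ≠ 0` and `∑ i, c i • v i = 0`. Picture
the rays as the vertices of a convex polygon. A nonzero relation has negative coefficients at two
vertices p, q and positive ones on both sides of the diagonal pq (`exists_separating_plane`). The
generators with positive coefficient thus split into two nonempty sets I₁ and I₂, and far out in the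
dual cone a lattice point is large on all of I₁ or on all of I₂ (`exists_separation`). The
"function" that is 1 along I₁ and 0 along I₂ then represents a nonzero class of degree zero in the
second local cohomology of T(c).

This is made explicit by parameters: x is an interior monomial, y a sum of facet monomials, z a sum
of edge monomials, all of large height. The pair x, y is regular on every T(b). The parts a, b, e of
x, y, z that are congruent to x, y, z along I₁ and to 0 along I₂ give an element xb - ya of T(c)
that z multiplies into (x, y)T(c), although it does not lie there itself
(`IsRaySystem.exists_parameters`).

For (1), the kernel of z on T/(x, y)T has finite length and is supported at R⁺. If Ext^i(R/R⁺, T)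
vanishes for i < 3, dimension shifting makes the inclusion of this kernel zero, so z is regular, and
hence c = 0 (`ker_mulEnd_eq_bot_of_subsingleton_ext`).

For (2), equality of the torus points means b i - b j = c + φᵀ(n) with c a relation. Let A be the
endomorphism ring and P = Hom(T(b j), ⨁ T(b i)), a projective A-module with T(b i - b j) ≅ T(c) as
an R-summand. The fibre of P at the unit of the torus is simple of projective dimension 3, so every
simple A-module has projective dimension 3. A nonzero kernel of z on P/(x, y)P would contain a
simple module of projective dimension at most 2 (`ker_eq_bot_of_isFiniteLength`). So z is regular
again, c = 0, and the monomial of degree n gives the isomorphism. -/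

lemma one_tmul_dual_injective {f g : Module.Dual ℤ M}
    (h : (1 : ℝ) ⊗ₜ[ℤ] f = (1 : ℝ) ⊗ₜ[ℤ] g) : f = g := by
  ext m
  have := congrArg (fun y => pairing M y ((1 : ℝ) ⊗ₜ[ℤ] m)) h
  simpa using this

lemma one_tmul_eq_zero {m : M} (h : (1 : ℝ) ⊗ₜ[ℤ] m = 0) : m = 0 := by
  let B := Module.Free.chooseBasis ℤ M
  apply B.ext_elem
  intro j
  have := congrArg (fun y => pairing M ((1 : ℝ) ⊗ₜ[ℤ] B.coord j) y) h
  simpa using this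

/-- If finitely many integral functionals are positive at a real point, they are simultaneously
positive at a lattice point. -/
lemma exists_lattice_point_pos {ι : Type*} [Finite ι] (w : ι → Module.Dual ℤ M)
    (x : ℝ ⊗[ℤ] M) (h : ∀ i, 0 < pairing M ((1 : ℝ) ⊗ₜ[ℤ] w i) x) :
    ∃ n : M, ∀ i, 0 < w i n := by
  let B := Module.Free.chooseBasis ℤ M
  let t := (B.baseChange ℝ).repr x
  have hx : ∀ f : Module.Dual ℤ M,
      pairing M ((1 : ℝ) ⊗ₜ[ℤ] f) x = ∑ a, t a * (f (B a) : ℝ) := by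
    intro f
    conv_lhs => rw [← (B.baseChange ℝ).sum_repr x]
    simp [t]
  -- Round the coordinates of N·x down: the value of `w i` grows linearly in N, while the rounding
  -- error is at most `∑ a, |w i (B a)|`.
  have key : ∀ i, ∀ᶠ N : ℕ in Filter.atTop, 0 < w i (∑ a, ⌊(N : ℝ) * t a⌋ • B a) := by
    intro i
    obtain ⟨N₀, hN₀⟩ := exists_nat_gt
      ((∑ a, |(w i (B a) : ℝ)|) / pairing M ((1 : ℝ) ⊗ₜ[ℤ] w i) x)
    filter_upwards [Filter.eventually_ge_atTop N₀] with N hN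
    have hN' : (N₀ : ℝ) ≤ N := by exact_mod_cast hN
    have h1 : (∑ a, |(w i (B a) : ℝ)|) < N * pairing M ((1 : ℝ) ⊗ₜ[ℤ] w i) x :=
      (div_lt_iff₀ (h i)).1 (hN₀.trans_le hN')
    have h2 : (0 : ℝ) < (w i (∑ a, ⌊(N : ℝ) * t a⌋ • B a) : ℤ) := by
      rw [hx, Finset.mul_sum] at h1
      simp only [map_sum, map_smul, smul_eq_mul, Int.cast_sum, Int.cast_mul]
      have h3 : ∑ a, ((N : ℝ) * (t a * (w i (B a) : ℝ)) - |(w i (B a) : ℝ)|) ≤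
          ∑ a, ((⌊(N : ℝ) * t a⌋ : ℤ) : ℝ) * (w i (B a) : ℝ) := by
        refine Finset.sum_le_sum fun a _ => ?_
        have h4 := Int.floor_le ((N : ℝ) * t a)
        have h5 := Int.lt_floor_add_one ((N : ℝ) * t a)
        rcases le_total 0 (w i (B a) : ℝ) with h6 | h6
        · rw [abs_of_nonneg h6]; nlinarith
        · rw [abs_of_nonpos h6]; nlinarith
      rw [Finset.sum_sub_distrib] at h3
      linarith
    exact_mod_cast h2
  obtain ⟨N, hN⟩ := (Filter.eventually_all.2 key).exists
  exact ⟨_, hN⟩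

variable {k : ℕ} {v : Fin k → Module.Dual ℤ M}

/-- The range of `f` is an ideal gℤ, and `f` is g times an integral functional; primitivity makes g
a unit. -/
lemma exists_eq_one_of_primitive {f : Module.Dual ℤ M}
    (hf : ∀ (n : ℤ) (w : Module.Dual ℤ M), f = n • w → IsUnit n) : ∃ e, f e = 1 := by
  let B := Module.Free.chooseBasis ℤ M
  obtain ⟨g, hg⟩ := (inferInstance : (LinearMap.range f).IsPrincipal)
  have hdvd : ∀ m, g ∣ f m := fun m => by
    have : f m ∈ Submodule.span ℤ {g} := hg ▸ LinearMap.mem_range_self f m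
    exact Ideal.mem_span_singleton.1 this
  choose q hq using hdvd
  have hunit := hf g (B.constr ℤ fun a => q (B a)) (B.ext fun a => by simp [← hq])
  have : (1 : ℤ) ∈ LinearMap.range f := by
    rw [hg]
    exact Ideal.mem_span_singleton.2 hunit.dvd
  exact this

lemma IsRaySystem.exists_eq_one (hv : IsRaySystem v) (i : Fin k) : ∃ e, v i e = 1 :=
  exists_eq_one_of_primitive (hv.primitive i)

/-- Every ray generator is cut out by a lattice point of the dual cone. -/
lemma IsRaySystem.exists_facet (hv : IsRaySystem v) (i : Fin k) :
    ∃ m : M, v i m = 0 ∧ ∀ l, l ≠ i → 0 < v l m := by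
  obtain ⟨e, he⟩ := hv.exists_eq_one i
  obtain ⟨x, hx, hface⟩ := hv.isFace i
  have h0 : pairing M ((1 : ℝ) ⊗ₜ[ℤ] v i) x = 0 :=
    ((hface _).1 (PointedCone.subset_hull (R := ℝ) (Set.mem_singleton _))).2
  have hpos : ∀ l, l ≠ i → 0 < pairing M ((1 : ℝ) ⊗ₜ[ℤ] v l) x := by
    intro l hl
    have hmem : (1 : ℝ) ⊗ₜ[ℤ] v l ∈ cone v :=
      PointedCone.subset_hull (R := ℝ) (Set.mem_range_self l)
    refine lt_of_le_of_ne (hx hmem) fun h => hl ?_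
    have := (hface _).2 ⟨hmem, h.symm⟩
    obtain ⟨r, hr⟩ := Submodule.mem_span_singleton.1 this
    replace hr : (r : ℝ) • ((1 : ℝ) ⊗ₜ[ℤ] v i) = (1 : ℝ) ⊗ₜ[ℤ] v l := hr
    have hev : ∀ n : M, (r : ℝ) * (v i n : ℝ) = (v l n : ℝ) := by
      intro n
      have := congrArg (fun y => pairing M y ((1 : ℝ) ⊗ₜ[ℤ] n)) hr
      rw [map_smul, LinearMap.smul_apply, pairing_tmul, pairing_tmul] at this
      simpa using this
    -- Evaluation at `e`, where `v i` is 1, shows that the nonnegative factor `r` is an integer;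
    -- primitivity of `v l` then forces it to be 1.
    have hr1 : (r : ℝ) = (v l e : ℝ) := by rw [← hev e, he]; simp
    have hvl : v l = (v l e) • v i := by
      ext n
      have := hev n
      rw [hr1] at this
      simp only [LinearMap.smul_apply, smul_eq_mul]
      exact_mod_cast this.symm
    have hr0 : (0 : ℤ) ≤ v l e := by exact_mod_cast hr1 ▸ r.2
    rcases Int.isUnit_iff.1 (hv.primitive l _ _ hvl) with h1 | h1
    · rw [h1, one_smul] at hvl
      exact hv.injective hvl
    · omega
  -- The functional `v l - v l e • v i` agrees with `v l` at `x` and vanishes at `e`, so its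
  -- positivity survives the projection of `n` along `e` to the hyperplane `v i = 0`.
  obtain ⟨n, hn⟩ := exists_lattice_point_pos (ι := {l // l ≠ i})
    (fun l => v l - v l e • v i) x (fun l => by
      rw [TensorProduct.tmul_sub, TensorProduct.tmul_smul, map_sub, map_zsmul,
        LinearMap.sub_apply, LinearMap.smul_apply, h0, smul_zero, sub_zero]
      exact hpos l l.2)
  refine ⟨n - v i n • e, by simp [he], fun l hl => ?_⟩
  have := hn ⟨l, hl⟩
  simp only [LinearMap.sub_apply, LinearMap.smul_apply, smul_eq_mul] at this
  simp only [map_sub, map_smul, smul_eq_mul]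
  linarith

lemma IsRaySystem.eq_zero (hv : IsRaySystem v) {n : M} (h : ∀ l, v l n = 0) : n = 0 := by
  apply one_tmul_eq_zero
  apply (phiPhiT_bijective hv).1
  rw [phiPhiT_apply, map_zero]
  simp [h]

lemma IsRaySystem.eq_of_forall_eq (hv : IsRaySystem v) {m n : M} (h : ∀ l, v l m = v l n) :
    m = n :=
  sub_eq_zero.1 (hv.eq_zero fun l => by simp [h])

lemma IsRaySystem.finrank_le (hv : IsRaySystem v) : Module.finrank ℤ M ≤ k := by
  have h1 : Module.finrank ℝ (ℝ ⊗[ℤ] Module.Dual ℤ M) = Module.finrank ℤ M := by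
    rw [Module.finrank_baseChange]
    exact (LinearEquiv.finrank_eq (Module.Free.chooseBasis ℤ M).toDualEquiv).symm
  have h2 := finrank_range_le_card (R := ℝ) (fun i => (1 : ℝ) ⊗ₜ[ℤ] v i)
  rw [Set.finrank, hv.span_eq_top, finrank_top, h1] at h2
  simpa using h2

end Lattice

/-! ### Sign patterns of relations between ray generators -/

section Separation

variable {M : Type u} [AddCommGroup M]

/-- The determinant of three functionals on a lattice of rank three with basis `B`. -/
def det3 (B : Module.Basis (Fin 3) ℤ M) (f g h : Module.Dual ℤ M) : ℤ :=
  f (B 0) * (g (B 1) * h (B 2) - g (B 2) * h (B 1)) -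
    f (B 1) * (g (B 0) * h (B 2) - g (B 2) * h (B 0)) +
    f (B 2) * (g (B 0) * h (B 1) - g (B 1) * h (B 0))

variable (B : Module.Basis (Fin 3) ℤ M)

lemma dual_apply_eq_sum (f : Module.Dual ℤ M) (n : M) :
    f n = B.repr n 0 * f (B 0) + B.repr n 1 * f (B 1) + B.repr n 2 * f (B 2) := by
  conv_lhs => rw [← B.sum_repr n, Fin.sum_univ_three]
  simp only [map_add, map_smul, smul_eq_mul]

/-- Cramer's rule for four functionals on a lattice of rank three. -/
lemma det3_cramer (f g h w : Module.Dual ℤ M) (n : M) :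
    det3 B f g h * w n = det3 B w g h * f n + det3 B f w h * g n + det3 B f g w * h n := by
  rw [dual_apply_eq_sum B f, dual_apply_eq_sum B g, dual_apply_eq_sum B h, dual_apply_eq_sum B w]
  simp only [det3]
  ring

lemma det3_rotate (f g h : Module.Dual ℤ M) : det3 B g h f = det3 B f g h := by
  simp only [det3]; ring

lemma det3_self_right (f g : Module.Dual ℤ M) : det3 B f g g = 0 := by
  simp only [det3]; ring

lemma det3_self_outer (f g : Module.Dual ℤ M) : det3 B f g f = 0 := by
  simp only [det3]; ring

lemma det3_sum {ι : Type*} (s : Finset ι) (c : ι → ℤ) (w : ι → Module.Dual ℤ M)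
    (f g : Module.Dual ℤ M) :
    det3 B f g (∑ i ∈ s, c i • w i) = ∑ i ∈ s, c i * det3 B f g (w i) := by
  classical
  induction s using Finset.induction_on with
  | empty => simp [det3]
  | insert a s ha ih =>
    rw [Finset.sum_insert ha, Finset.sum_insert ha, ← ih]
    simp only [det3, LinearMap.add_apply, LinearMap.smul_apply, smul_eq_mul]
    ring

/-- Linearly independent functionals on a lattice of rank three have nonzero determinant. -/
lemma exists_relation_of_det3_eq_zero {f g h : Module.Dual ℤ M} (hd : det3 B f g h = 0) :
    ∃ a b c : ℤ, (a ≠ 0 ∨ b ≠ 0 ∨ c ≠ 0) ∧ ∀ n, a * f n + b * g n + c * h n = 0 := by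
  let A : Matrix (Fin 3) (Fin 3) ℤ := !![f (B 0), f (B 1), f (B 2); g (B 0), g (B 1), g (B 2);
    h (B 0), h (B 1), h (B 2)]
  have hA : A.det = 0 := by
    rw [← hd, Matrix.det_fin_three]
    simp [A, det3]
    ring
  obtain ⟨x, hx0, hx⟩ := Matrix.exists_vecMul_eq_zero_iff.2 hA
  refine ⟨x 0, x 1, x 2, ?_, fun n => ?_⟩
  · by_contra! hcon
    exact hx0 (by ext i; fin_cases i <;> simp [hcon])
  · have h0 := congrFun hx 0
    have h1 := congrFun hx 1
    have h2 := congrFun hx 2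
    simp [A, Matrix.vecMul, dotProduct, Fin.sum_univ_three] at h0 h1 h2
    rw [dual_apply_eq_sum B f, dual_apply_eq_sum B g, dual_apply_eq_sum B h]
    linear_combination (B.repr n 0) * h0 + (B.repr n 1) * h1 + (B.repr n 2) * h2

variable {k : ℕ} {v : Fin k → Module.Dual ℤ M} {μ : Fin k → M}
  (h0 : ∀ i, v i (μ i) = 0) (hpos : ∀ i l, l ≠ i → 0 < v l (μ i))

include h0 hpos

/-- A relation between three generators, evaluated at the facet point of one of them, shows that the
other two coefficients have opposite signs or both vanish. Three nonzero numbers cannot have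
pairwise opposite signs. -/
lemma det3_ne_zero {i j l : Fin k} (hij : i ≠ j) (hil : i ≠ l) (hjl : j ≠ l) :
    det3 B (v i) (v j) (v l) ≠ 0 := by
  intro hd
  obtain ⟨a, b, c, hne, hrel⟩ := exists_relation_of_det3_eq_zero B hd
  have hi := hrel (μ i)
  have hj := hrel (μ j)
  have hl := hrel (μ l)
  simp only [h0, mul_zero, zero_add, add_zero] at hi hj hl
  have p1 := hpos i j hij.symm
  have p2 := hpos i l hil.symm
  have p3 := hpos j i hij
  have p4 := hpos j l hjl.symm
  have p5 := hpos l i hil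
  have p6 := hpos l j hjl
  rcases lt_trichotomy a 0 with ha | ha | ha
  · have hc : 0 < c := by
      by_contra! h; nlinarith
    have hb : 0 < b := by
      by_contra! h; nlinarith
    nlinarith
  · subst ha
    simp only [zero_mul, zero_add, mul_eq_zero, p4.ne', p6.ne', or_false] at hj hl
    simp_all
  · have hc : c < 0 := by
      by_contra! h; nlinarith
    have hb : b < 0 := by
      by_contra! h; nlinarith
    nlinarith

include B in
/-- Two lattice points of the dual cone on the same edge and of the same height agree. -/
lemma dual_eq_of_edge {i j : Fin k} (hij : i ≠ j) (hk : 3 ≤ k) {m m' : M}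
    (hm : ∀ l, 0 ≤ v l m) (hm' : ∀ l, 0 ≤ v l m') (hmi : v i m = 0)
    (hmj : v j m = 0) (hmi' : v i m' = 0)
    (hmj' : v j m' = 0) (hh : ∑ l, v l m = ∑ l, v l m') (l : Fin k) : v l m = v l m' := by
  obtain ⟨r, hri, hrj⟩ : ∃ r : Fin k, i ≠ r ∧ j ≠ r := by
    by_contra! hcon
    have : (Finset.univ : Finset (Fin k)) ⊆ {i, j} := by
      intro r _
      by_cases h : i = r
      · simp [h]
      · simp [hcon r h]
    have := Finset.card_le_card this
    have h2 : ({i, j} : Finset (Fin k)).card ≤ 2 := Finset.card_le_two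
    simp at this
    omega
  have hd := det3_ne_zero B h0 hpos hij hri hrj
  -- On the edge `v i = v j = 0`, Cramer's rule makes each `v s n` a fixed multiple of `v r n`.
  have key : ∀ n : M, v i n = 0 → v j n = 0 → ∀ s,
      det3 B (v i) (v j) (v r) * v s n = det3 B (v i) (v j) (v s) * v r n := by
    intro n hi hj s
    rw [det3_cramer B (v i) (v j) (v r) (v s) n, hi, hj]
    ring
  have hr : v r m = v r m' := by
    have e1 : det3 B (v i) (v j) (v r) * ∑ l, v l m =
        (∑ s, det3 B (v i) (v j) (v s)) * v r m := by
      rw [Finset.mul_sum, Finset.sum_mul]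
      exact Finset.sum_congr rfl fun s _ => key m hmi hmj s
    have e2 : det3 B (v i) (v j) (v r) * ∑ l, v l m =
        (∑ s, det3 B (v i) (v j) (v s)) * v r m' := by
      rw [hh, Finset.mul_sum, Finset.sum_mul]
      exact Finset.sum_congr rfl fun s _ => key m' hmi' hmj' s
    -- If the factor relating `v r` to the height degenerates, the height is zero and all the
    -- nonnegative values vanish.
    by_cases hK : ∑ s, det3 B (v i) (v j) (v s) = 0
    · rw [hK, zero_mul] at e1
      have hz : ∑ l, v l m = 0 := (mul_eq_zero.1 e1).resolve_left hd
      rw [(Finset.sum_eq_zero_iff_of_nonneg fun l _ => hm l).1 hz r (Finset.mem_univ r),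
        (Finset.sum_eq_zero_iff_of_nonneg fun l _ => hm' l).1 (hh ▸ hz) r (Finset.mem_univ r)]
    · exact mul_left_cancel₀ hK (e1.symm.trans e2)
  apply mul_left_cancel₀ hd
  rw [key m hmi hmj, key m' hmi' hmj', hr]

/-- The four point relation among ray generators: if, seen from `i`, the generator `j` lies between
`p` and `q`, then `j` and `i` are on different sides of the plane through `p` and `q`. -/
lemma det3_neg_of_between {i p q j : Fin k} (hij : i ≠ j) (hpj : p ≠ j) (hqj : q ≠ j)
    (h1 : 0 < det3 B (v i) (v p) (v j)) (h2 : 0 < det3 B (v i) (v j) (v q)) :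
    det3 B (v p) (v q) (v j) < 0 := by
  -- At `μ j` the functional `v j` vanishes and the others are positive: three determinants with
  -- positive weights sum to zero, and two of them are positive.
  have h := det3_cramer B (v i) (v p) (v q) (v j) (μ j)
  rw [h0, mul_zero, det3_rotate B (v j) (v p) (v q) |>.symm] at h
  have p1 := hpos j i hij
  have p2 := mul_pos h2 (hpos j p hpj)
  have p3 := mul_pos h1 (hpos j q hqj)
  by_contra! hcon
  have := mul_nonneg hcon p1.le
  linarith

/-- A relation `∑ cᵢ vᵢ = 0` with `c ≠ 0` among ray generators changes sign in both directions
across a suitable plane through two ray generators with negative coefficient. -/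
lemma exists_separating_plane {c : Fin k → ℤ} (hk : 2 ≤ k) (hc : ∑ i, c i • v i = 0)
    (hne : c ≠ 0) :
    ∃ p q : Fin k, p ≠ q ∧ c p < 0 ∧ c q < 0 ∧
      (∃ i, 0 < c i ∧ 0 < det3 B (v p) (v q) (v i)) ∧
      (∃ i, 0 < c i ∧ det3 B (v p) (v q) (v i) < 0) := by
  have hcn : ∀ n, ∑ i, c i * v i n = 0 := fun n => by
    have := congrArg (fun f : Module.Dual ℤ M => f n) hc
    simpa using this
  have : Nontrivial (Fin k) := Fin.nontrivial_iff_two_le.2 hk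
  have hint : ∀ l, 0 < v l (∑ i, μ i) := by
    intro l
    rw [map_sum]
    obtain ⟨s, hs⟩ := exists_ne l
    refine Finset.sum_pos' (fun i _ => ?_) ⟨s, Finset.mem_univ s, hpos s l hs.symm⟩
    by_cases h : l = i
    · rw [h, h0]
    · exact (hpos i l h).le
  have hposex : ∃ i, 0 < c i := by
    by_contra! hcon
    have := (Finset.sum_eq_zero_iff_of_nonpos fun i _ =>
      mul_nonpos_of_nonpos_of_nonneg (hcon i) (hint i).le).1 (hcn _)
    exact hne (funext fun i => (mul_eq_zero.1 (this i (Finset.mem_univ i))).resolve_right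
      (hint i).ne')
  have hnegex : ∃ i, c i < 0 := by
    by_contra! hcon
    have := (Finset.sum_eq_zero_iff_of_nonneg fun i _ =>
      mul_nonneg (hcon i) (hint i).le).1 (hcn _)
    exact hne (funext fun i => (mul_eq_zero.1 (this i (Finset.mem_univ i))).resolve_right
      (hint i).ne')
  obtain ⟨i₀, hi₀⟩ := hposex
  obtain ⟨n₀, hn₀⟩ := hnegex
  obtain ⟨r, hr⟩ := exists_ne i₀
  -- The slope of the ray `v j` seen from `v i₀`. All other rays are positive on `μ i₀`, so slopes
  -- order them linearly, and Cramer's rule turns comparison of slopes into the sign of a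
  -- determinant.
  let s : Fin k → ℚ := fun j => (det3 B (v i₀) (v r) (v j) : ℚ) / (v j (μ i₀) : ℚ)
  have hs : ∀ a b, a ≠ i₀ → b ≠ i₀ → (s a ≤ s b ↔ 0 ≤ det3 B (v i₀) (v a) (v b)) := by
    intro a b ha hb
    have ea : (0 : ℚ) < v a (μ i₀) := by exact_mod_cast hpos i₀ a ha
    have eb : (0 : ℚ) < v b (μ i₀) := by exact_mod_cast hpos i₀ b hb
    have er := hpos i₀ r hr
    have h := det3_cramer B (v i₀) (v r) (v b) (v a) (μ i₀)
    rw [h0, mul_zero, zero_add] at h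
    rw [div_le_div_iff₀ ea eb]
    have h' : det3 B (v i₀) (v a) (v b) * v r (μ i₀) =
      det3 B (v i₀) (v r) (v b) * v a (μ i₀) - det3 B (v i₀) (v r) (v a) * v b (μ i₀) := by
      linarith
    constructor
    · intro hle
      have hle' : det3 B (v i₀) (v r) (v a) * v b (μ i₀) ≤
        det3 B (v i₀) (v r) (v b) * v a (μ i₀) := by exact_mod_cast hle
      exact nonneg_of_mul_nonneg_left (by linarith) er
    · intro hle
      have := mul_nonneg hle er.le
      have hle' : det3 B (v i₀) (v r) (v a) * v b (μ i₀) ≤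
        det3 B (v i₀) (v r) (v b) * v a (μ i₀) := by linarith
      exact_mod_cast hle'
  let Neg : Finset (Fin k) := Finset.univ.filter fun i => c i < 0
  have hNeg : Neg.Nonempty := ⟨n₀, by simp [Neg, hn₀]⟩
  -- `p` and `q` are the outermost negative generators seen from `i₀`. The other negative ones lie
  -- between them, hence beyond the plane through `p` and `q`. If no positive generator were beyond
  -- it, the vanishing sum of the `c j * det3 B (v p) (v q) (v j)` would have nonnegative terms and
  -- a positive one at `i₀`.
  obtain ⟨p, hp, hpmin⟩ := Finset.exists_min_image Neg s hNeg
  obtain ⟨q, hq, hqmax⟩ := Finset.exists_max_image Neg s hNeg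
  simp only [Neg, Finset.mem_filter, Finset.mem_univ, true_and] at hp hq hpmin hqmax
  have hne₀ : ∀ j, c j < 0 → j ≠ i₀ := by
    rintro j hj rfl; omega
  have strict : ∀ a b, c a < 0 → c b < 0 → a ≠ b → s a ≤ s b →
      0 < det3 B (v i₀) (v a) (v b) := fun a b ha hb hab hle =>
    lt_of_le_of_ne ((hs a b (hne₀ a ha) (hne₀ b hb)).1 hle)
      (det3_ne_zero B h0 hpos (hne₀ a ha).symm (hne₀ b hb).symm hab).symm
  have hpq : p ≠ q := by
    rintro rfl
    -- With a single negative coefficient, the relation evaluated at `μ p` is a sum of nonnegative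
    -- terms, one of them positive.
    have huniq : ∀ j, c j < 0 → j = p := by
      intro j hj
      by_contra hjp
      have e1 := strict p j hp hj (Ne.symm hjp) (hpmin j hj)
      have e2 := strict j p hj hp hjp (hqmax j hj)
      have e3 : det3 B (v i₀) (v j) (v p) = -det3 B (v i₀) (v p) (v j) := by
        simp only [det3]; ring
      omega
    have hterm : ∀ j, 0 ≤ c j * v j (μ p) := by
      intro j
      by_cases hj : j = p
      · rw [hj, h0, mul_zero]
      · refine mul_nonneg ?_ (hpos p j hj).le
        by_contra! hcj
        exact hj (huniq j hcj)
    have := (Finset.sum_eq_zero_iff_of_nonneg fun i _ => hterm i).1 (hcn (μ p)) i₀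
      (Finset.mem_univ _)
    have h1 := mul_pos hi₀ (hpos p i₀ (hne₀ p hp).symm)
    omega
  have hDi₀ : 0 < det3 B (v p) (v q) (v i₀) := by
    rw [det3_rotate]
    exact strict p q hp hq hpq (hpmin q hq)
  refine ⟨p, q, hpq, hp, hq, ⟨i₀, hi₀, hDi₀⟩, ?_⟩
  by_contra! hcon
  have hsum : ∑ i, c i * det3 B (v p) (v q) (v i) = 0 := by
    rw [← det3_sum, hc]
    simp [det3]
  have hterm : ∀ j, 0 ≤ c j * det3 B (v p) (v q) (v j) := by
    intro j
    rcases lt_trichotomy (c j) 0 with hj | hj | hj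
    · by_cases hjp : j = p
      · rw [hjp, det3_self_outer, mul_zero]
      by_cases hjq : j = q
      · rw [hjq, det3_self_right, mul_zero]
      · have := det3_neg_of_between B h0 hpos (hne₀ j hj).symm (Ne.symm hjp) (Ne.symm hjq)
          (strict p j hp hj (Ne.symm hjp) (hpmin j hj)) (strict j q hj hq hjq (hqmax j hj))
        exact mul_nonneg_of_nonpos_of_nonpos hj.le this.le
    · rw [hj, zero_mul]
    · exact mul_nonneg hj.le (hcon j hj)
  have := (Finset.sum_eq_zero_iff_of_nonneg fun i _ => hterm i).1 hsum i₀ (Finset.mem_univ _)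
  have h1 := mul_pos hi₀ hDi₀
  omega

/-- Lattice points of the dual cone that are bounded on two generators on different sides of a
plane through two other generators have bounded height. -/
lemma exists_height_bound {p q i j : Fin k} (hpq : p ≠ q)
    (hip : i ≠ p) (hiq : i ≠ q) (hjp : j ≠ p) (hjq : j ≠ q)
    (hi : 0 < det3 B (v p) (v q) (v i)) (hj : det3 B (v p) (v q) (v j) < 0) (C : ℤ) :
    ∃ H : ℤ, ∀ m, (∀ l, 0 ≤ v l m) → v i m ≤ C → v j m ≤ C → ∑ l, v l m ≤ H := by
  set Di := det3 B (v p) (v q) (v i) with hDi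
  set Dj := det3 B (v p) (v q) (v j) with hDj
  set S := det3 B (v i) (v j) (v q)
  set T := det3 B (v i) (v p) (v j)
  -- Both coefficients on the left, `Di` and `-Dj`, are positive; evaluation at `μ p` and `μ q`
  -- shows that `T` and `S` are positive too. Bounds on `v i`, `v j` therefore bound `v p`, `v q`,
  -- and Cramer's rule then bounds every `v l`.
  have cr : ∀ n, Di * v j n - Dj * v i n = S * v p n + T * v q n := by
    intro n
    have := det3_cramer B (v i) (v p) (v q) (v j) n
    rw [← det3_rotate B (v i), ← det3_rotate B (v j)] at this
    rw [hDi, hDj]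
    linarith
  have hT : 0 < T := by
    have h := cr (μ p)
    rw [h0, mul_zero, zero_add] at h
    have e1 := mul_pos hi (hpos p j hjp)
    have e2 := mul_neg_of_neg_of_pos hj (hpos p i hip)
    exact pos_of_mul_pos_left (by linarith) (hpos p q hpq.symm).le
  have hS : 0 < S := by
    have h := cr (μ q)
    rw [h0 q, mul_zero, add_zero] at h
    have e1 := mul_pos hi (hpos q j hjq)
    have e2 := mul_neg_of_neg_of_pos hj (hpos q i hiq)
    exact pos_of_mul_pos_left (by linarith) (hpos q p hpq).le
  set K := (Di - Dj) * C
  refine ⟨∑ l, (|det3 B (v l) (v p) (v q)| * |C| + |det3 B (v i) (v l) (v q)| * |K| +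
    |det3 B (v i) (v p) (v l)| * |K|), fun m hm hmi hmj => Finset.sum_le_sum fun l _ => ?_⟩
  have e0 := cr m
  have b1 : Di * v j m ≤ Di * C := mul_le_mul_of_nonneg_left hmj hi.le
  have b2 : -Dj * v i m ≤ -Dj * C := mul_le_mul_of_nonneg_left hmi (by linarith)
  have b3 : S * v p m + T * v q m ≤ K := by
    simp only [K]; linarith
  have b4 : v p m ≤ S * v p m := le_mul_of_one_le_left (hm p) hS
  have b5 : v q m ≤ T * v q m := le_mul_of_one_le_left (hm q) hT
  have b6 := mul_nonneg hS.le (hm p)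
  have b7 := mul_nonneg hT.le (hm q)
  have b8 : v p m ≤ |K| := (by linarith : v p m ≤ K).trans (le_abs_self K)
  have b9 : v q m ≤ |K| := (by linarith : v q m ≤ K).trans (le_abs_self K)
  have b10 : v i m ≤ |C| := hmi.trans (le_abs_self C)
  have main := det3_cramer B (v i) (v p) (v q) (v l) m
  rw [← det3_rotate B (v i) (v p) (v q), ← hDi] at main
  have b11 : v l m ≤ Di * v l m := le_mul_of_one_le_left (hm l) hi
  have aux : ∀ a x X : ℤ, 0 ≤ x → x ≤ X → a * x ≤ |a| * X := fun a x X hx hX =>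
    (mul_le_mul_of_nonneg_right (le_abs_self a) hx).trans
      (mul_le_mul_of_nonneg_left hX (abs_nonneg a))
  have := aux (det3 B (v l) (v p) (v q)) _ _ (hm i) b10
  have := aux (det3 B (v i) (v l) (v q)) _ _ (hm p) b8
  have := aux (det3 B (v i) (v p) (v l)) _ _ (hm q) b9
  linarith

include B in
/-- A nonzero relation among ray generators splits its positive part into two nonempty parts that
are far from each other: only boundedly high points of the dual cone are small on both parts. -/
theorem exists_separation {c : Fin k → ℤ} (hk : 2 ≤ k) (hc : ∑ i, c i • v i = 0)
    (hne : c ≠ 0) :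
    ∃ I₁ I₂ : Set (Fin k), I₁.Nonempty ∧ I₂.Nonempty ∧
      (∀ i, 0 < c i ↔ i ∈ I₁ ∨ i ∈ I₂) ∧
      ∃ H : ℤ, ∀ m, (∀ l, 0 ≤ v l m) → H < ∑ l, v l m →
        (∀ i ∈ I₁, c i ≤ v i m) ∨ (∀ i ∈ I₂, c i ≤ v i m) := by
  obtain ⟨p, q, hpq, hp, hq, ⟨i₁, hi₁, hi₁'⟩, ⟨i₂, hi₂, hi₂'⟩⟩ :=
    exists_separating_plane B h0 hpos hk hc hne
  -- The two parts will be the positive generators on either side of the plane. The bound carries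
  -- its conditions as premises, so that it can be chosen for all pairs and summed.
  have hb : ∀ i j : Fin k, ∃ H : ℤ, (0 < c i ∧ 0 < det3 B (v p) (v q) (v i)) →
      (0 < c j ∧ det3 B (v p) (v q) (v j) < 0) →
      ∀ m, (∀ l, 0 ≤ v l m) → v i m ≤ max (c i) (c j) → v j m ≤ max (c i) (c j) →
        ∑ l, v l m ≤ H := by
    intro i j
    by_cases h : (0 < c i ∧ 0 < det3 B (v p) (v q) (v i)) ∧
      (0 < c j ∧ det3 B (v p) (v q) (v j) < 0)
    · obtain ⟨⟨hci, hi⟩, hcj, hj⟩ := h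
      obtain ⟨H, hH⟩ := exists_height_bound B h0 hpos hpq (i := i) (j := j) (by rintro rfl; omega)
        (by rintro rfl; omega) (by rintro rfl; omega) (by rintro rfl; omega) hi hj
        (max (c i) (c j))
      exact ⟨H, fun _ _ => hH⟩
    · exact ⟨0, fun h1 h2 => absurd ⟨h1, h2⟩ h⟩
  choose H hH using hb
  refine ⟨{i | 0 < c i ∧ 0 < det3 B (v p) (v q) (v i)},
    {i | 0 < c i ∧ det3 B (v p) (v q) (v i) < 0}, ⟨i₁, hi₁, hi₁'⟩, ⟨i₂, hi₂, hi₂'⟩, ?_,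
    ∑ i, ∑ j, |H i j|, ?_⟩
  · intro i
    constructor
    · intro hi
      have : det3 B (v p) (v q) (v i) ≠ 0 :=
        det3_ne_zero B h0 hpos hpq (by rintro rfl; omega) (by rintro rfl; omega)
      rcases this.lt_or_gt with h | h
      · exact Or.inr ⟨hi, h⟩
      · exact Or.inl ⟨hi, h⟩
    · rintro (h | h) <;> exact h.1
  · intro m hm hlt
    by_contra! hcon
    obtain ⟨⟨i, hi, hi'⟩, ⟨j, hj, hj'⟩⟩ := hcon
    have h1 := hH i j hi hj m hm (hi'.le.trans (le_max_left _ _)) (hj'.le.trans (le_max_right _ _))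
    have h2 : |H i j| ≤ ∑ j, |H i j| :=
      Finset.single_le_sum (f := fun j => |H i j|) (fun _ _ => abs_nonneg _) (Finset.mem_univ j)
    have h3 : ∑ j, |H i j| ≤ ∑ i, ∑ j, |H i j| :=
      Finset.single_le_sum (f := fun i => ∑ j, |H i j|)
        (fun _ _ => Finset.sum_nonneg fun _ _ => abs_nonneg _) (Finset.mem_univ i)
    have h4 := le_abs_self (H i j)
    linarith

end Separation

/-! ### Orders of Laurent polynomials, and finiteness of the toric ring -/

section Laurent

variable {M : Type u} [AddCommGroup M]

namespace LaurentRing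

/-- The coefficient of the monomial of degree `m`. -/
def coeff (m : M) : LaurentRing M →ₗ[ℂ] ℂ where
  toFun f := AddMonoidAlgebra.coeff f m
  map_add' _ _ := rfl
  map_smul' _ _ := rfl

lemma mem_supp {f : LaurentRing M} {m : M} : m ∈ f.supp ↔ coeff m f ≠ 0 := Finsupp.mem_support_iff

lemma coeff_monomial_self (m : M) : coeff m (monomial m) = 1 :=
  Finsupp.single_eq_same

lemma coeff_monomial_ne {m n : M} (h : m ≠ n) : coeff n (monomial m) = 0 :=
  Finsupp.single_eq_of_ne' h

lemma monomial_zero : monomial (0 : M) = 1 := rfl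

lemma monomial_add (m n : M) : monomial (m + n) = monomial m * monomial n := by
  change (AddMonoidAlgebra.single (m + n) (1 : ℂ) : AddMonoidAlgebra ℂ M) =
    AddMonoidAlgebra.single m (1 : ℂ) * AddMonoidAlgebra.single n (1 : ℂ)
  rw [AddMonoidAlgebra.single_mul_single, one_mul]

lemma monomial_nsmul (n : ℕ) (m : M) : monomial (n • m) = monomial m ^ n := by
  induction n with
  | zero => simp [monomial_zero]
  | succ n ih => rw [succ_nsmul, monomial_add, ih, pow_succ]

lemma monomial_mul_monomial_neg (m : M) : monomial m * monomial (-m) = 1 := by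
  rw [← monomial_add, add_neg_cancel, monomial_zero]

lemma monomial_neg_mul_monomial (m : M) : monomial (-m) * monomial m = 1 := by
  rw [mul_comm, monomial_mul_monomial_neg]

lemma coeff_monomial_mul (m n : M) (f : LaurentRing M) :
    coeff n (monomial m * f) = coeff (n - m) f := by
  have h := AddMonoidAlgebra.coeff_single_mul_apply (R := ℂ) (f : AddMonoidAlgebra ℂ M) 1 m n
  rw [one_mul, neg_add_eq_sub] at h
  exact h

lemma eq_sum (f : LaurentRing M) : f = ∑ m ∈ f.supp, coeff m f • monomial m := by
  refine (AddMonoidAlgebra.sum_coeff_single (f : AddMonoidAlgebra ℂ M)).symm.trans ?_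
  refine Finset.sum_congr rfl fun m _ => ?_
  change _ = coeff m f • AddMonoidAlgebra.single m (1 : ℂ)
  rw [AddMonoidAlgebra.smul_single, smul_eq_mul, mul_one]
  rfl

instance [Module.Free ℤ M] : IsDomain (LaurentRing M) :=
  let B := Module.Free.chooseBasis ℤ M
  have : UniqueSums M := UniqueSums.of_injective_addHom
    (⟨B.repr, map_add B.repr⟩ : M →ₙ+ _) B.repr.injective inferInstance
  inferInstanceAs (IsDomain (AddMonoidAlgebra ℂ M))

lemma monomial_ne_zero (m : M) : monomial m ≠ (0 : LaurentRing M) := fun h => by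
  simpa [h] using coeff_monomial_self m

lemma monomial_injective : Function.Injective (monomial : M → LaurentRing M) := by
  intro m n h
  by_contra hne
  have := coeff_monomial_ne hne
  rw [h, coeff_monomial_self] at this
  exact one_ne_zero this

/-- Laurent polynomials all of whose monomials have degree at least `a` with respect to `f`. -/
def halfSpace (f : Module.Dual ℤ M) (a : ℤ) : Submodule ℂ (LaurentRing M) where
  carrier := {h | ∀ m, coeff m h ≠ 0 → a ≤ f m}
  add_mem' {g h} hg hh m hm := by
    by_cases h0 : coeff m g = 0
    · exact hh m (by simpa [h0] using hm)
    · exact hg m h0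
  zero_mem' m hm := by simp at hm
  smul_mem' r h hh m hm := hh m fun h0 => hm (by simp [h0])

lemma mem_halfSpace {f : Module.Dual ℤ M} {a : ℤ} {h : LaurentRing M} :
    h ∈ halfSpace f a ↔ ∀ m, coeff m h ≠ 0 → a ≤ f m := Iff.rfl

lemma monomial_mem_halfSpace {f : Module.Dual ℤ M} {a : ℤ} {m : M} :
    monomial m ∈ halfSpace f a ↔ a ≤ f m := by
  constructor
  · intro h
    exact h m (by simp [coeff_monomial_self])
  · intro h n hn
    by_cases hmn : m = n
    · exact hmn ▸ h
    · exact absurd (coeff_monomial_ne hmn) hn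

lemma mul_mem_halfSpace {f : Module.Dual ℤ M} {a b : ℤ} {g h : LaurentRing M}
    (hg : g ∈ halfSpace f a) (hh : h ∈ halfSpace f b) : g * h ∈ halfSpace f (a + b) := by
  intro m hm
  obtain ⟨x, hx, y, hy, rfl⟩ := mem_supp_mul (mem_supp.2 hm)
  rw [map_add]
  exact add_le_add (hg x (mem_supp.1 hx)) (hh y (mem_supp.1 hy))

lemma halfSpace_anti {f : Module.Dual ℤ M} {a b : ℤ} (h : a ≤ b) :
    halfSpace f b ≤ halfSpace f a := fun _ hg m hm => h.trans (hg m hm)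

lemma monomial_mul_mem_halfSpace {f : Module.Dual ℤ M} {a : ℤ} {m : M} {h : LaurentRing M} :
    monomial m * h ∈ halfSpace f (a + f m) ↔ h ∈ halfSpace f a := by
  constructor
  · intro hh n hn
    have := hh (n + m) (by rwa [coeff_monomial_mul, add_sub_cancel_right])
    rw [map_add] at this
    omega
  · intro hh
    rw [add_comm a]
    exact mul_mem_halfSpace (monomial_mem_halfSpace.2 le_rfl) hh

/-- If the initial part of `y` with respect to `f` is a single monomial, then multiplication by `y`
reflects membership in half spaces. -/
lemma mem_halfSpace_of_mul_mem {f : Module.Dual ℤ M} {a : ℤ} {m : M} {y h : LaurentRing M}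
    (hm : f m = 0) (hy : y - monomial m ∈ halfSpace f 1) (hyh : y * h ∈ halfSpace f a) :
    h ∈ halfSpace f a := by
  by_contra hcon
  simp only [mem_halfSpace, not_forall, not_le] at hcon
  obtain ⟨n, hn, hna⟩ := hcon
  -- At a term `p` of least order in `h`, the term `p + m` of `monomial m * h` cannot be cancelled,
  -- since `(y - monomial m) * h` has order at least `1 + f p`.
  obtain ⟨p, hp, hpmin⟩ := Finset.exists_min_image h.supp f ⟨n, mem_supp.2 hn⟩
  have hpa : f p < a := (hpmin n (mem_supp.2 hn)).trans_lt hna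
  have h1 : (y - monomial m) * h ∈ halfSpace f (1 + f p) :=
    mul_mem_halfSpace hy fun q hq => hpmin q (mem_supp.2 hq)
  have h2 : coeff (p + m) ((y - monomial m) * h) = 0 := by
    by_contra h3
    have := h1 _ h3
    rw [map_add, hm] at this
    omega
  rw [sub_mul, map_sub, coeff_monomial_mul, add_sub_cancel_right] at h2
  have := hyh (p + m) (by rw [sub_eq_zero.1 h2]; exact mem_supp.1 hp)
  rw [map_add, hm] at this
  omega

end LaurentRing

open LaurentRing

variable {k : ℕ} {v : Fin k → Module.Dual ℤ M}

lemma mem_rankOne {b : Fin k → ℤ} {h : LaurentRing M} :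
    h ∈ rankOne v b ↔ ∀ i, h ∈ halfSpace (v i) (b i) :=
  ⟨fun hh i m hm => hh m (mem_supp.2 hm) i, fun hh m hm i => hh i m (mem_supp.1 hm)⟩

lemma mem_toricRing {h : LaurentRing M} : h ∈ toricRing v ↔ ∀ i, h ∈ halfSpace (v i) 0 :=
  ⟨fun hh i m hm => (one_tmul_mem_dualCone v).1 (hh m (mem_supp.2 hm)) i,
    fun hh m hm => (one_tmul_mem_dualCone v).2 fun i => hh i m (mem_supp.1 hm)⟩

lemma mem_rankOne_zero {h : LaurentRing M} : h ∈ rankOne v 0 ↔ h ∈ toricRing v := by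
  rw [mem_rankOne, mem_toricRing]; rfl

lemma monomial_mem_toricRing {m : M} : monomial m ∈ toricRing v ↔ ∀ i, 0 ≤ v i m := by
  simp [mem_toricRing, monomial_mem_halfSpace]

lemma monomial_mem_rankOne {b : Fin k → ℤ} {m : M} :
    monomial m ∈ rankOne v b ↔ ∀ i, b i ≤ v i m := by
  simp [mem_rankOne, monomial_mem_halfSpace]

lemma mul_mem_rankOne {b c : Fin k → ℤ} {g h : LaurentRing M} (hg : g ∈ rankOne v b)
    (hh : h ∈ rankOne v c) : g * h ∈ rankOne v (b + c) :=
  mem_rankOne.2 fun i => mul_mem_halfSpace (mem_rankOne.1 hg i) (mem_rankOne.1 hh i)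

lemma toricRing_mul_mem_rankOne {b : Fin k → ℤ} {r h : LaurentRing M} (hr : r ∈ toricRing v)
    (hh : h ∈ rankOne v b) : r * h ∈ rankOne v b :=
  (rankOne v b).smul_mem ⟨r, hr⟩ hh

lemma monomial_mul_mem_rankOne {b : Fin k → ℤ} {m : M} {h : LaurentRing M} :
    monomial m * h ∈ rankOne v (b + phiT v m) ↔ h ∈ rankOne v b := by
  simp only [mem_rankOne]
  exact forall_congr' fun i => monomial_mul_mem_halfSpace

/-- Multiplication by a monomial identifies `T(b)` with `T(b + φᵀ(m))`. -/
def rankOneShift (b : Fin k → ℤ) (m : M) : rankOne v b ≃ₗ[toricRing v] rankOne v (b + phiT v m) where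
  toFun h := ⟨monomial m * h, monomial_mul_mem_rankOne.2 h.2⟩
  invFun h := ⟨monomial (-m) * h, by
    have := monomial_mul_mem_rankOne (m := -m).2 h.2
    simpa using this⟩
  map_add' g h := Subtype.ext (mul_add _ _ _)
  map_smul' r h := Subtype.ext (mul_left_comm _ _ _)
  left_inv h := Subtype.ext (by
    change monomial (-m) * (monomial m * (h : LaurentRing M)) = h
    rw [← mul_assoc, monomial_neg_mul_monomial, one_mul])
  right_inv h := Subtype.ext (by
    change monomial m * (monomial (-m) * (h : LaurentRing M)) = h
    rw [← mul_assoc, monomial_mul_monomial_neg, one_mul])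

section FiniteType

variable [Module.Free ℤ M] [Module.Finite ℤ M]

/-- The monoid of lattice points of the dual cone is finitely generated. -/
lemma IsRaySystem.exists_generators (hv : IsRaySystem v) :
    ∃ t : Finset M, (∀ m ∈ t, ∀ i, 0 ≤ v i m) ∧
      ∀ m, (∀ i, 0 ≤ v i m) → m ∈ AddSubmonoid.closure (t : Set M) := by
  classical
  -- Gordan's lemma: the `v i` embed the monoid in ℕ^k, and the image contains every difference of
  -- its elements that stays in ℕ^k; such submonoids are finitely generated.
  let P : AddSubmonoid (Fin k → ℕ) :=
    { carrier := {x | ∃ m, ∀ i, v i m = x i}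
      add_mem' := by
        rintro x y ⟨m, hm⟩ ⟨n, hn⟩
        exact ⟨m + n, fun i => by simp [hm, hn]⟩
      zero_mem' := ⟨0, fun i => by simp⟩ }
  obtain ⟨s, hs⟩ : P.FG := AddSubmonoid.fg_of_subtractive (by
    rintro x ⟨m, hm⟩ y ⟨n, hn⟩
    refine ⟨n - m, fun i => ?_⟩
    have := hn i
    simp only [Pi.add_apply, Nat.cast_add] at this
    rw [map_sub, hm, this]
    ring)
  have hsP : ∀ x ∈ s, x ∈ P := fun x hx => hs ▸ AddSubmonoid.subset_closure hx
  choose! g hg using hsP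
  refine ⟨s.image g, ?_, ?_⟩
  · intro m hm i
    obtain ⟨x, hx, rfl⟩ := Finset.mem_image.1 hm
    rw [hg x hx]
    exact Int.natCast_nonneg _
  · have key : ∀ x ∈ AddSubmonoid.closure (s : Set (Fin k → ℕ)),
        ∃ m ∈ AddSubmonoid.closure ((s.image g : Finset M) : Set M), ∀ i, v i m = x i := by
      intro x hx
      induction hx using AddSubmonoid.closure_induction with
      | mem x hx =>
        exact ⟨g x, AddSubmonoid.subset_closure (by simpa using ⟨x, hx, rfl⟩), hg x hx⟩
      | zero => exact ⟨0, zero_mem _, fun i => by simp⟩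
      | add x y _ _ hx hy =>
        obtain ⟨m, hm, hm'⟩ := hx
        obtain ⟨n, hn, hn'⟩ := hy
        exact ⟨m + n, add_mem hm hn, fun i => by simp [hm', hn']⟩
    intro m hm
    obtain ⟨n, hn, hn'⟩ := key (fun i => (v i m).toNat) (by
      rw [hs]
      exact ⟨m, fun i => (Int.toNat_of_nonneg (hm i)).symm⟩)
    have : m = n := hv.eq_of_forall_eq fun l => by
      rw [hn' l]
      exact (Int.toNat_of_nonneg (hm l)).symm
    rwa [this]

lemma IsRaySystem.finiteType (hv : IsRaySystem v) : Algebra.FiniteType ℂ (toricRing v) := by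
  classical
  obtain ⟨t, ht, hgen⟩ := hv.exists_generators
  rw [← Subalgebra.fg_iff_finiteType]
  refine ⟨t.image monomial, le_antisymm ?_ ?_⟩
  · refine Algebra.adjoin_le ?_
    intro f hf
    obtain ⟨m, hm, rfl⟩ := Finset.mem_image.1 (Finset.mem_coe.1 hf)
    exact monomial_mem_toricRing.2 (ht m hm)
  · intro f hf
    rw [eq_sum f]
    refine Subalgebra.sum_mem _ fun m hm => Subalgebra.smul_mem _ ?_ _
    have hmem := hgen m fun i => mem_toricRing.1 hf i m (mem_supp.1 hm)
    clear hm
    induction hmem using AddSubmonoid.closure_induction with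
    | mem x hx => exact Algebra.subset_adjoin (by simpa using ⟨x, hx, rfl⟩)
    | zero => exact monomial_zero (M := M) ▸ one_mem _
    | add x y _ _ hx hy =>
      exact monomial_add x y ▸ mul_mem hx hy

lemma IsRaySystem.isNoetherianRing (hv : IsRaySystem v) : IsNoetherianRing (toricRing v) :=
  have := hv.finiteType
  Algebra.FiniteType.isNoetherianRing ℂ _

/-- The sum of the facet points works: each `v l` vanishes on exactly one of them, and there are at
least two. -/
lemma IsRaySystem.exists_interior (hv : IsRaySystem v) (hM : Module.finrank ℤ M = 3) :
    ∃ u : M, ∀ l, 0 < v l u := by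
  choose μ h0 hpos using hv.exists_facet
  have hk := hv.finrank_le
  have : Nontrivial (Fin k) := Fin.nontrivial_iff_two_le.2 (by omega)
  refine ⟨∑ i, μ i, fun l => ?_⟩
  rw [map_sum]
  obtain ⟨s, hs⟩ := exists_ne l
  refine Finset.sum_pos' (fun i _ => ?_) ⟨s, Finset.mem_univ s, hpos s l hs.symm⟩
  by_cases h : l = i
  · rw [h, h0]
  · exact (hpos i l h).le

/-- Far along an interior direction, all lower bounds are satisfied. -/
lemma exists_nsmul_ge {ι : Type*} [Fintype ι] {w : ι → Module.Dual ℤ M} {u : M}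
    (hu : ∀ l, 0 < w l u) (b : ι → ℤ) :
    ∃ N : ℕ, ∀ l, b l ≤ w l (N • u) := by
  refine ⟨∑ l, (b l).natAbs, fun l => ?_⟩
  have h1 : (b l).natAbs ≤ ∑ l, (b l).natAbs :=
    Finset.single_le_sum (f := fun l => (b l).natAbs) (fun _ _ => Nat.zero_le _)
      (Finset.mem_univ l)
  rw [map_nsmul, nsmul_eq_mul]
  have h2 := hu l
  have h3 : ((b l).natAbs : ℤ) ≤ (∑ l, (b l).natAbs : ℕ) := by exact_mod_cast h1
  have h4 : b l ≤ ((b l).natAbs : ℤ) := Int.le_natAbs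
  nlinarith

/-- A monomial far inside the dual cone multiplies T(b) injectively into the Noetherian ring R. -/
lemma IsRaySystem.isNoetherian_rankOne (hv : IsRaySystem v) (hM : Module.finrank ℤ M = 3)
    (b : Fin k → ℤ) : IsNoetherian (toricRing v) (rankOne v b) := by
  obtain ⟨u, hu⟩ := hv.exists_interior hM
  obtain ⟨N, hN⟩ := exists_nsmul_ge hu (-b)
  have := hv.isNoetherianRing
  have hmem : ∀ h : rankOne v b, monomial (N • u) * (h : LaurentRing M) ∈ toricRing v := fun h =>
    mem_rankOne_zero.1 (mem_rankOne.2 fun i => halfSpace_anti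
      (by
        have h1 := hN i
        have h2 : (b + phiT v (N • u)) i = b i + v i (N • u) := rfl
        rw [Pi.neg_apply] at h1
        rw [h2, Pi.zero_apply]
        omega)
      (mem_rankOne.1 (monomial_mul_mem_rankOne.2 h.2) i))
  let f : rankOne v b →ₗ[toricRing v] toricRing v :=
    { toFun := fun h => ⟨_, hmem h⟩
      map_add' := fun g h => Subtype.ext (mul_add _ _ _)
      map_smul' := fun r h => Subtype.ext (mul_left_comm _ _ _) }
  refine isNoetherian_of_injective f fun g h hgh => Subtype.ext ?_
  exact mul_left_cancel₀ (monomial_ne_zero (N • u)) (congrArg Subtype.val hgh)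

end FiniteType

end Laurent

/-! ### Parameters that detect a relation -/

section Parameters

open LaurentRing

variable {M : Type u} [AddCommGroup M] {k : ℕ} {v : Fin k → Module.Dual ℤ M}

variable (v) in
/-- The monomial of a lattice point of the dual cone, as an element of the toric ring. -/
def toricMonomial (m : M) (hm : ∀ i, 0 ≤ v i m) : toricRing v :=
  ⟨monomial m, monomial_mem_toricRing.2 hm⟩

lemma toricMonomial_add {m n : M} (hm : ∀ i, 0 ≤ v i m) (hn : ∀ i, 0 ≤ v i n)
    (hmn : ∀ i, 0 ≤ v i (m + n)) :
    toricMonomial v (m + n) hmn = toricMonomial v m hm * toricMonomial v n hn :=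
  Subtype.ext (monomial_add m n)

lemma toricMonomial_nsmul {m : M} (hm : ∀ i, 0 ≤ v i m) (n : ℕ) (hn : ∀ i, 0 ≤ v i (n • m)) :
    toricMonomial v (n • m) hn = toricMonomial v m hm ^ n :=
  Subtype.ext (monomial_nsmul n m)

/-- The n-th power of the monomial of `m` is divisible by that of `m'`, because `n • m - m'` lies in
the dual cone. -/
lemma toricMonomial_mem_radical {J : Ideal (toricRing v)} {m m' : M} (hm : ∀ i, 0 ≤ v i m)
    (hm' : ∀ i, 0 ≤ v i m') (h : toricMonomial v m' hm' ∈ J.radical) (n : ℕ)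
    (hn : ∀ i, v i m' ≤ v i (n • m)) : toricMonomial v m hm ∈ J.radical := by
  have h1 : ∀ i, 0 ≤ v i (n • m - m') := fun i => by
    rw [map_sub]; exact sub_nonneg.2 (hn i)
  have h2 : toricMonomial v m hm ^ n = toricMonomial v (n • m - m') h1 * toricMonomial v m' hm' := by
    apply Subtype.ext
    change monomial m ^ n = monomial (n • m - m') * monomial m'
    rw [← monomial_add, sub_add_cancel, monomial_nsmul]
  apply J.radical_idem.le
  exact ⟨n, h2 ▸ J.radical.mul_mem_left _ h⟩

lemma eq_sum_toricMonomial (f : toricRing v) :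
    f = ∑ m ∈ f.1.supp.attach, coeff m.1 f.1 •
      toricMonomial v m.1 fun i => mem_toricRing.1 f.2 i m.1 (mem_supp.1 m.2) := by
  apply Subtype.ext
  conv_lhs => rw [eq_sum f.1, ← Finset.sum_attach]
  rw [AddSubmonoidClass.coe_finsetSum]
  rfl

/-- A quotient of the toric ring in which all nontrivial monomials are nilpotent is finite
dimensional. -/
lemma finite_quotient_of_monomials [Algebra.FiniteType ℂ (toricRing v)]
    {J : Ideal (toricRing v)}
    (h : ∀ m hm, m ≠ 0 → toricMonomial v m hm ∈ J.radical) :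
    Module.Finite ℂ (toricRing v ⧸ J) := by
  have : Algebra.FiniteType ℂ (toricRing v ⧸ J) :=
    Algebra.FiniteType.of_surjective (Ideal.Quotient.mkₐ ℂ J) (Ideal.Quotient.mkₐ_surjective ℂ J)
  -- A finitely generated integral algebra is finite; here every element is a combination of 1 and
  -- nilpotent monomials.
  have : Algebra.IsIntegral ℂ (toricRing v ⧸ J) := by
    constructor
    intro q
    obtain ⟨f, rfl⟩ := Ideal.Quotient.mkₐ_surjective ℂ J q
    rw [eq_sum_toricMonomial f, map_sum]
    refine IsIntegral.sum _ fun m _ => ?_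
    rw [map_smul]
    refine IsIntegral.smul _ ?_
    by_cases hm : m.1 = 0
    · have h1 : toricMonomial v m.1 (fun i => mem_toricRing.1 f.2 i m.1 (mem_supp.1 m.2)) = 1 :=
        Subtype.ext (by simp only [toricMonomial, hm, monomial_zero]; rfl)
      rw [h1, map_one]
      exact isIntegral_one
    · obtain ⟨n, hn⟩ := h m.1 (fun i => mem_toricRing.1 f.2 i m.1 (mem_supp.1 m.2)) hm
      refine IsIntegral.of_pow (n := n + 1) n.succ_pos ?_
      rw [← map_pow, pow_succ, map_mul]
      rw [show (Ideal.Quotient.mkₐ ℂ J) (_ ^ n) = 0 from Ideal.Quotient.eq_zero_iff_mem.2 hn,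
        zero_mul]
      exact isIntegral_zero
  exact Algebra.IsIntegral.finite

variable [Module.Free ℤ M] [Module.Finite ℤ M]

/-- The height of a lattice point. -/
def height (v : Fin k → Module.Dual ℤ M) : Module.Dual ℤ M := ∑ l, v l

lemma height_apply (m : M) : height v m = ∑ l, v l m := by simp [height]

lemma IsRaySystem.height_pos (hv : IsRaySystem v) {m : M} (hm : ∀ i, 0 ≤ v i m) (h : m ≠ 0) :
    0 < height v m := by
  rw [height_apply]
  refine (Finset.sum_nonneg fun l _ => hm l).lt_of_ne fun h0 => h ?_
  exact hv.eq_zero fun l => (Finset.sum_eq_zero_iff_of_nonneg fun l _ => hm l).1 h0.symm l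
    (Finset.mem_univ l)

lemma IsRaySystem.eq_of_edge (hv : IsRaySystem v) (hM : Module.finrank ℤ M = 3) {i j : Fin k}
    (hij : i ≠ j) {m m' : M} (hm : ∀ l, 0 ≤ v l m) (hm' : ∀ l, 0 ≤ v l m') (hmi : v i m = 0)
    (hmj : v j m = 0) (hmi' : v i m' = 0) (hmj' : v j m' = 0)
    (hh : height v m = height v m') : m = m' := by
  choose μ h0 hpos using hv.exists_facet
  refine hv.eq_of_forall_eq (dual_eq_of_edge (Module.finBasisOfFinrankEq ℤ M hM) h0 hpos hij
    (hM ▸ hv.finrank_le) hm hm' hmi hmj hmi' hmj' ?_)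
  rwa [height_apply, height_apply] at hh

/-- There is a finite set of lattice points of the same large height that meets exactly the edges
of the dual cone. -/
lemma IsRaySystem.exists_edge_points (hv : IsRaySystem v) (hM : Module.finrank ℤ M = 3) (H : ℤ) :
    ∃ (d : ℤ) (Z : Finset M), H < d ∧
      (∀ m ∈ Z, (∀ l, 0 ≤ v l m) ∧ height v m = d) ∧
      ∀ m, (∀ l, 0 ≤ v l m) → m ≠ 0 → (∃ i j, i ≠ j ∧ v i m = 0 ∧ v j m = 0) →
        ∃ m' ∈ Z, ∃ a b : ℕ, b ≠ 0 ∧ a • m = b • m' := by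
  classical
  -- Edges are indexed by pairs of generators with a common nonzero zero in the dual cone. A point
  -- `ρ p` is chosen on each and scaled to the height `D`, a common multiple of the chosen heights
  -- exceeding `H`.
  let E : Fin k × Fin k → M → Prop := fun p ρ =>
    p.1 ≠ p.2 ∧ (∀ l, 0 ≤ v l ρ) ∧ 0 < height v ρ ∧ v p.1 ρ = 0 ∧ v p.2 ρ = 0
  let P : Finset (Fin k × Fin k) := Finset.univ.filter fun p => ∃ ρ, E p ρ
  have hP : ∀ p ∈ P, ∃ ρ, E p ρ := fun p hp => (Finset.mem_filter.1 hp).2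
  choose! ρ hρ using hP
  let d : Fin k × Fin k → ℕ := fun p => (height v (ρ p)).toNat
  have hd : ∀ p ∈ P, (d p : ℤ) = height v (ρ p) := fun p hp =>
    Int.toNat_of_nonneg (hρ p hp).2.2.1.le
  have hdpos : ∀ p ∈ P, 0 < d p := fun p hp => by
    have := hd p hp
    have := (hρ p hp).2.2.1
    omega
  let D : ℕ := (H.natAbs + 1) * ∏ p ∈ P, d p
  have hprod : 1 ≤ ∏ p ∈ P, d p := Finset.prod_pos hdpos
  have hDH : H < D := by
    have h1 : H.natAbs + 1 ≤ D := Nat.le_mul_of_pos_right _ hprod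
    omega
  have hDd : ∀ p ∈ P, D / d p * d p = D := fun p hp =>
    Nat.div_mul_cancel (dvd_mul_of_dvd_right (Finset.dvd_prod_of_mem d hp) _)
  have hheight : ∀ p ∈ P, height v ((D / d p) • ρ p) = D := by
    intro p hp
    rw [map_nsmul, ← hd p hp, nsmul_eq_mul]
    exact_mod_cast hDd p hp
  refine ⟨D, P.image fun p => (D / d p) • ρ p, hDH, ?_, ?_⟩
  · intro m hm
    obtain ⟨p, hp, rfl⟩ := Finset.mem_image.1 hm
    refine ⟨fun l => ?_, hheight p hp⟩
    rw [map_nsmul]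
    exact nsmul_nonneg ((hρ p hp).2.1 l) _
  · rintro m hm hne ⟨i, j, hij, hi, hj⟩
    have hpos := hv.height_pos hm hne
    have hp : (i, j) ∈ P := Finset.mem_filter.2 ⟨Finset.mem_univ _, m, hij, hm, hpos, hi, hj⟩
    obtain ⟨-, h1, h2, h3, h4⟩ := hρ _ hp
    -- Both multiples lie on the same edge and have height `D * height v m`, so they coincide.
    refine ⟨_, Finset.mem_image_of_mem _ hp, D, (height v m).toNat, by omega, ?_⟩
    refine hv.eq_of_edge hM hij ?_ ?_ ?_ ?_ ?_ ?_ ?_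
    · intro l; rw [map_nsmul]; exact nsmul_nonneg (hm l) _
    · intro l; rw [map_nsmul, map_nsmul]; exact nsmul_nonneg (nsmul_nonneg (h1 l) _) _
    · rw [map_nsmul, hi, nsmul_zero]
    · rw [map_nsmul, hj, nsmul_zero]
    · rw [map_nsmul, map_nsmul, h3, nsmul_zero, nsmul_zero]
    · rw [map_nsmul, map_nsmul, h4, nsmul_zero, nsmul_zero]
    · rw [map_nsmul, map_nsmul _ (height v m).toNat, hheight _ hp, nsmul_eq_mul, nsmul_eq_mul,
        Int.toNat_of_nonneg hpos.le, mul_comm]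

section Radical

variable {μ : Fin k → M} (h0 : ∀ i, v i (μ i) = 0) (hpos : ∀ i l, l ≠ i → 0 < v l (μ i))
  {u : M} (hu : ∀ i, 0 ≤ v i u) {Z : Finset M} {d : ℤ}
  (hZ : ∀ m ∈ Z, (∀ l, 0 ≤ v l m) ∧ height v m = d)
  {J : Ideal (toricRing v)}

include h0 hpos in
lemma facet_nonneg (i l : Fin k) : 0 ≤ v l (μ i) := by
  by_cases h : l = i
  · rw [h, h0]
  · exact (hpos i l h).le

lemma interior_mem_radical (hx : toricMonomial v u hu ∈ J) {m : M} (hm : ∀ i, 0 < v i m) :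
    toricMonomial v m (fun i => (hm i).le) ∈ J.radical := by
  obtain ⟨N, hN⟩ := exists_nsmul_ge hm (fun i => v i u)
  exact toricMonomial_mem_radical _ hu (J.le_radical hx) N hN

/-- Multiplying the sum of the facet monomials by the i-th one gives its square plus interior
monomials, which are already in the radical. A monomial vanishing at most on `v i` has a power
divisible by that facet monomial or is itself interior. -/
lemma facet_mem_radical (hx : toricMonomial v u hu ∈ J)
    (hy : ∑ i, toricMonomial v (μ i) (facet_nonneg h0 hpos i) ∈ J) {m : M} {i : Fin k}
    (hm : ∀ l, 0 ≤ v l m) (hml : ∀ l, l ≠ i → 0 < v l m) :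
    toricMonomial v m hm ∈ J.radical := by
  have hnn := facet_nonneg h0 hpos
  have hμ : toricMonomial v (μ i) (hnn i) ∈ J.radical := by
    apply J.radical_idem.le
    refine ⟨2, ?_⟩
    have h1 : toricMonomial v (μ i) (hnn i) * ∑ l, toricMonomial v (μ l) (hnn l) ∈ J.radical :=
      J.le_radical (J.mul_mem_left _ hy)
    rw [Finset.mul_sum, ← Finset.add_sum_erase _ _ (Finset.mem_univ i), ← pow_two] at h1
    refine (Ideal.add_mem_iff_left _ (Ideal.sum_mem _ fun l hl => ?_)).1 h1
    have hli : l ≠ i := Finset.ne_of_mem_erase hl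
    have hint : ∀ s, 0 < v s (μ i + μ l) := by
      intro s
      rw [map_add]
      by_cases hs : s = i
      · exact add_pos_of_nonneg_of_pos (hnn i s) (hpos l s (hs ▸ hli.symm))
      · exact add_pos_of_pos_of_nonneg (hpos i s hs) (hnn l s)
    rw [← toricMonomial_add _ _ fun s => (hint s).le]
    exact interior_mem_radical hu hx hint
  by_cases hmi : v i m = 0
  · obtain ⟨N, hN⟩ := exists_nsmul_ge (w := fun l : {l : Fin k // l ≠ i} => v l)
      (u := m) (fun l => hml l l.2) (fun l => v l (μ i))
    refine toricMonomial_mem_radical _ (hnn i) hμ N fun l => ?_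
    by_cases hl : l = i
    · rw [hl, h0, map_nsmul, hmi, nsmul_zero]
    · exact hN ⟨l, hl⟩
  · refine interior_mem_radical hu hx fun l => ?_
    by_cases hl : l = i
    · exact hl ▸ (hm i).lt_of_ne (Ne.symm hmi)
    · exact hml l hl

include hZ in
/-- All nontrivial monomials are nilpotent modulo the three parameters attached to the interior,
the facets and the edges of the dual cone. -/
lemma toricMonomial_mem_radical_parameters (hv : IsRaySystem v) (hM : Module.finrank ℤ M = 3)
    (hx : toricMonomial v u hu ∈ J)
    (hy : ∑ i, toricMonomial v (μ i) (facet_nonneg h0 hpos i) ∈ J)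
    (hz : ∑ m ∈ Z.attach, toricMonomial v m.1 (hZ m.1 m.2).1 ∈ J)
    (hedge : ∀ m, (∀ l, 0 ≤ v l m) → m ≠ 0 → (∃ i j, i ≠ j ∧ v i m = 0 ∧ v j m = 0) →
        ∃ m' ∈ Z, ∃ a b : ℕ, b ≠ 0 ∧ a • m = b • m')
    (m : M) (hm : ∀ l, 0 ≤ v l m) (hne : m ≠ 0) : toricMonomial v m hm ∈ J.radical := by
  classical
  have hk : 3 ≤ k := hM ▸ hv.finrank_le
  have base : ∀ n (hn : ∀ l, 0 ≤ v l n), (¬ ∃ i j, i ≠ j ∧ v i n = 0 ∧ v j n = 0) →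
      toricMonomial v n hn ∈ J.radical := by
    intro n hn hcon
    by_cases hi : ∃ i, v i n = 0
    · obtain ⟨i, hi⟩ := hi
      refine facet_mem_radical h0 hpos hu hx hy (i := i) hn fun l hl => ?_
      exact (hn l).lt_of_ne fun h => hcon ⟨l, i, hl, h.symm, hi⟩
    · push Not at hi
      exact interior_mem_radical hu hx fun l => (hn l).lt_of_ne (hi l).symm
  by_cases he : ∃ i j, i ≠ j ∧ v i m = 0 ∧ v j m = 0
  swap
  · exact base m hm he
  obtain ⟨m', hm', a, b, hb, hab⟩ := hedge m hm hne he
  have hnn := (hZ m' hm').1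
  -- The squaring argument again: the product of two distinct edge points of equal height vanishes
  -- on at most one generator, so `base` applies to the cross terms.
  have key : toricMonomial v m' hnn ∈ J.radical := by
    apply J.radical_idem.le
    refine ⟨2, ?_⟩
    have h1 : toricMonomial v m' hnn * ∑ n ∈ Z.attach, toricMonomial v n.1 (hZ n.1 n.2).1 ∈
        J.radical := J.le_radical (J.mul_mem_left _ hz)
    rw [Finset.mul_sum, ← Finset.add_sum_erase _ _ (Finset.mem_attach Z ⟨m', hm'⟩),
      ← pow_two] at h1
    refine (Ideal.add_mem_iff_left _ (Ideal.sum_mem _ fun n hn => ?_)).1 h1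
    have hne' : n.1 ≠ m' := fun h => Finset.ne_of_mem_erase hn (Subtype.ext h)
    have hnn' := (hZ n.1 n.2).1
    rw [← toricMonomial_add _ _ fun s => by
      rw [map_add]; exact add_nonneg (hnn s) (hnn' s)]
    refine base _ _ ?_
    rintro ⟨i, j, hij, hi, hj⟩
    rw [map_add] at hi hj
    have e1 := hnn i
    have e2 := hnn j
    have e3 := hnn' i
    have e4 := hnn' j
    exact hne' (hv.eq_of_edge hM hij hnn' hnn (by omega) (by omega) (by omega) (by omega)
      ((hZ n.1 n.2).2.trans (hZ m' hm').2.symm))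
  refine toricMonomial_mem_radical hm (m' := b • m')
    (fun l => by rw [map_nsmul]; exact nsmul_nonneg (hnn l) _) ?_ a fun l => hab ▸ le_rfl
  rw [toricMonomial_nsmul hnn]
  exact Ideal.pow_mem_of_mem _ key b (Nat.pos_of_ne_zero hb)

end Radical

/-- Sums of monomials of large height split compatibly with a separation of generators. -/
lemma exists_split {c : Fin k → ℤ} {I₁ I₂ : Set (Fin k)} {H : ℤ}
    (hH : ∀ m, (∀ l, 0 ≤ v l m) → H < ∑ l, v l m →
        (∀ i ∈ I₁, c i ≤ v i m) ∨ (∀ i ∈ I₂, c i ≤ v i m))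
    {ι : Type*} (s : Finset ι) (w : ι → M) (hw : ∀ j ∈ s, ∀ l, 0 ≤ v l (w j))
    (hwH : ∀ j ∈ s, H < height v (w j)) :
    ∃ a : LaurentRing M, a ∈ toricRing v ∧
      (∀ i ∈ I₁, a - ∑ j ∈ s, monomial (w j) ∈ halfSpace (v i) (c i)) ∧
      (∀ i ∈ I₂, a ∈ halfSpace (v i) (c i)) := by
  classical
  -- Keep the monomials that are large on all of `I₂`; by separation the discarded ones are large on
  -- all of `I₁`.
  refine ⟨∑ j ∈ s with ∀ i ∈ I₂, c i ≤ v i (w j), monomial (w j), ?_, ?_, ?_⟩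
  · exact Subalgebra.sum_mem _ fun j hj =>
      monomial_mem_toricRing.2 (hw j (Finset.mem_filter.1 hj).1)
  · intro i hi
    rw [← Finset.sum_filter_add_sum_filter_not s (fun j => ∀ i ∈ I₂, c i ≤ v i (w j)),
      sub_add_cancel_left]
    refine neg_mem (Submodule.sum_mem _ fun j hj => monomial_mem_halfSpace.2 ?_)
    obtain ⟨hj, hj'⟩ := Finset.mem_filter.1 hj
    exact (hH (w j) (hw j hj) (height_apply (v := v) (w j) ▸ hwH j hj)).resolve_right hj' i hi
  · intro i hi
    exact Submodule.sum_mem _ fun j hj =>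
      monomial_mem_halfSpace.2 ((Finset.mem_filter.1 hj).2 i hi)

/-- The fractions a/f and b/g both imitate the function that is 1 along `I₁` and 0 along `I₂`, so
their cross difference vanishes to order `c i` along both parts. Where `c i ≤ 0`, membership in R
suffices. -/
lemma split_cross_mem {c : Fin k → ℤ} {I₁ I₂ : Set (Fin k)}
    (hI : ∀ i, 0 < c i ↔ i ∈ I₁ ∨ i ∈ I₂) {f g a b : LaurentRing M}
    (hf : f ∈ toricRing v) (hg : g ∈ toricRing v) (ha : a ∈ toricRing v) (hb : b ∈ toricRing v)
    (ha₁ : ∀ i ∈ I₁, a - f ∈ halfSpace (v i) (c i)) (ha₂ : ∀ i ∈ I₂, a ∈ halfSpace (v i) (c i))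
    (hb₁ : ∀ i ∈ I₁, b - g ∈ halfSpace (v i) (c i)) (hb₂ : ∀ i ∈ I₂, b ∈ halfSpace (v i) (c i)) :
    f * b - g * a ∈ rankOne v c := by
  rw [mem_rankOne]
  intro i
  have mul : ∀ {x y : LaurentRing M}, x ∈ toricRing v → y ∈ halfSpace (v i) (c i) →
      x * y ∈ halfSpace (v i) (c i) := fun hx hy =>
    zero_add (c i) ▸ mul_mem_halfSpace (mem_toricRing.1 hx i) hy
  by_cases hi : 0 < c i
  · rcases (hI i).1 hi with h | h
    · have : f * b - g * a = f * (b - g) - g * (a - f) := by ring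
      rw [this]
      exact sub_mem (mul hf (hb₁ i h)) (mul hg (ha₁ i h))
    · exact sub_mem (mul hf (hb₂ i h)) (mul hg (ha₂ i h))
  · refine halfSpace_anti (not_lt.1 hi) (mem_toricRing.1 ?_ i)
    exact sub_mem (mul_mem hf hb) (mul_mem hg ha)

/-- A nonzero element `c` of the kernel of `φ` gives a system of parameters of the toric ring, the
first two of which are regular on all modules `T(b)`, while all three are not regular on `T(c)` and
its translates. -/
theorem IsRaySystem.exists_parameters (hv : IsRaySystem v) (hM : Module.finrank ℤ M = 3)
    {c : Fin k → ℤ} (hc : ∑ i, c i • v i = 0) (hne : c ≠ 0) :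
    ∃ x y z : toricRing v, x ≠ 0 ∧
      (∀ b, ∀ t ∈ rankOne v b, ∀ s ∈ rankOne v b, (y : LaurentRing M) * t = x * s →
        ∃ t' ∈ rankOne v b, t = x * t') ∧
      (∀ m hm, m ≠ 0 → toricMonomial v m hm ∈ (Ideal.span {x, y, z}).radical) ∧
      ∀ n, ∃ p ∈ rankOne v (c + phiT v n),
        (∃ s ∈ rankOne v (c + phiT v n), ∃ t ∈ rankOne v (c + phiT v n),
          (z : LaurentRing M) * p = x * s + y * t) ∧
        ¬ ∃ s ∈ rankOne v (c + phiT v n), ∃ t ∈ rankOne v (c + phiT v n),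
          p = x * s + y * t := by
  have hk : 3 ≤ k := hM ▸ hv.finrank_le
  have : Nontrivial (Fin k) := Fin.nontrivial_iff_two_le.2 (by omega)
  choose μ₀ h0₀ hpos₀ using hv.exists_facet
  obtain ⟨I₁, I₂, ⟨i₁, hi₁⟩, ⟨i₂, hi₂⟩, hI, H, hH⟩ :=
    exists_separation (Module.finBasisOfFinrankEq ℤ M hM) h0₀ hpos₀ (by omega) hc hne
  -- Scaling by `N` lifts the facet points above the height `H` beyond which monomials split.
  let N : ℕ := H.natAbs + 1
  let μ : Fin k → M := fun i => N • μ₀ i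
  have h0 : ∀ i, v i (μ i) = 0 := fun i => by simp [μ, h0₀]
  have hpos : ∀ i l, l ≠ i → 0 < v l (μ i) := fun i l hl => by
    simp only [μ, map_nsmul]
    exact nsmul_pos (hpos₀ i l hl) (by omega)
  have hnn := facet_nonneg h0 hpos
  have hμH : ∀ i, H < height v (μ i) := by
    intro i
    obtain ⟨s, hs⟩ := exists_ne i
    have h1 : 0 < height v (μ₀ i) := by
      rw [height_apply]
      exact Finset.sum_pos' (fun l _ => facet_nonneg h0₀ hpos₀ i l)
        ⟨s, Finset.mem_univ s, hpos₀ i s hs⟩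
    simp only [μ, map_nsmul, nsmul_eq_mul]
    have h2 : H < (N : ℤ) := by omega
    nlinarith
  let u : M := ∑ i, μ i
  have hu : ∀ l, 0 < v l u := by
    intro l
    obtain ⟨s, hs⟩ := exists_ne l
    rw [map_sum]
    exact Finset.sum_pos' (fun i _ => hnn i l) ⟨s, Finset.mem_univ s, hpos s l hs.symm⟩
  have huH : H < height v u := by
    have h1 : height v (μ i₁) ≤ height v u := by
      rw [map_sum]
      refine Finset.single_le_sum (f := fun i => height v (μ i)) (fun i _ => ?_)
        (Finset.mem_univ i₁)
      rw [height_apply]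
      exact Finset.sum_nonneg fun l _ => hnn i l
    exact (hμH i₁).trans_le h1
  have hu' : ∀ l, 0 ≤ v l u := fun l => (hu l).le
  obtain ⟨d, Z, hdH, hZ, hedge⟩ := hv.exists_edge_points hM H
  let x : toricRing v := toricMonomial v u hu'
  let y : toricRing v := ∑ i, toricMonomial v (μ i) (hnn i)
  let z : toricRing v := ∑ m ∈ Z.attach, toricMonomial v m.1 (hZ m.1 m.2).1
  have hxc : (x : LaurentRing M) = monomial u := rfl
  have hyc : (y : LaurentRing M) = ∑ i, monomial (μ i) := by
    simp only [y, AddSubmonoidClass.coe_finsetSum]; rfl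
  have hzc : (z : LaurentRing M) = ∑ m ∈ Z, monomial m := by
    simp only [z, AddSubmonoidClass.coe_finsetSum]
    exact Finset.sum_attach Z monomial
  -- Along `v i` the only term of `y` of order zero is `monomial (μ i)`, so multiplication by `y`
  -- reflects order bounds along each generator.
  have hyinit : ∀ i, (y : LaurentRing M) - monomial (μ i) ∈ halfSpace (v i) 1 := by
    classical
    intro i
    rw [hyc, ← Finset.add_sum_erase _ _ (Finset.mem_univ i), add_sub_cancel_left]
    exact Submodule.sum_mem _ fun l hl =>
      monomial_mem_halfSpace.2 (hpos l i (Finset.ne_of_mem_erase hl).symm)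
  have hyreg : ∀ (i : Fin k) (a : ℤ) (h : LaurentRing M), (y : LaurentRing M) * h ∈ halfSpace (v i) a →
      h ∈ halfSpace (v i) a := fun i a h hh => mem_halfSpace_of_mul_mem (h0 i) (hyinit i) hh
  refine ⟨x, y, z, fun h => monomial_ne_zero u (congrArg Subtype.val h), ?_, ?_, ?_⟩
  -- From `y * t = x * s`, the product `y * t` lies in x T(b), which is cut out by orders; hence `t`
  -- does too.
  · intro b t ht s hs hyt
    have hmem : t ∈ rankOne v (b + phiT v u) := mem_rankOne.2 fun i =>
      hyreg i _ _ (by rw [hyt, hxc]; exact mem_rankOne.1 (monomial_mul_mem_rankOne.2 hs) i)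
    have ht' : t = monomial u * (monomial (-u) * t) := by
      rw [← mul_assoc, monomial_mul_monomial_neg, one_mul]
    exact ⟨monomial (-u) * t, monomial_mul_mem_rankOne.1 (ht' ▸ hmem), ht'⟩
  · exact toricMonomial_mem_radical_parameters h0 hpos hu' hZ hv hM
      (Ideal.subset_span (by simp [x])) (Ideal.subset_span (by simp [y]))
      (Ideal.subset_span (by simp [z])) hedge
  -- `a`, `b`, `e` are the parts of `x`, `y`, `z` congruent to them along `I₁` and to 0 along `I₂`.
  -- The witness is `x * b - y * a`, and the relation for `z` is the expansion of a 3×3 determinant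
  -- with a repeated row.
  · obtain ⟨a, ha, ha₁, ha₂⟩ := exists_split hH (Finset.univ : Finset Unit) (fun _ => u)
      (fun _ _ => hu') (fun _ _ => huH)
    obtain ⟨b, hb, hb₁, hb₂⟩ := exists_split hH (Finset.univ : Finset (Fin k)) μ
      (fun i _ => hnn i) (fun i _ => hμH i)
    obtain ⟨e, he, he₁, he₂⟩ := exists_split hH Z id
      (fun m hm => (hZ m hm).1) (fun m hm => (hZ m hm).2 ▸ hdH)
    rw [Finset.univ_unique, Finset.sum_singleton, ← hxc] at ha₁
    rw [← hyc] at hb₁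
    simp only [id] at he₁
    rw [← hzc] at he₁
    have hp := split_cross_mem hI x.2 y.2 ha hb ha₁ ha₂ hb₁ hb₂
    have hzy := split_cross_mem hI y.2 z.2 hb he hb₁ hb₂ he₁ he₂
    have hzx := split_cross_mem hI x.2 z.2 ha he ha₁ ha₂ he₁ he₂
    have hcore : ¬ ∃ s ∈ rankOne v c, ∃ t ∈ rankOne v c,
        (x : LaurentRing M) * b - y * a = x * s + y * t := by
      rintro ⟨s, hs, t, ht, heq⟩
      -- Here g = (a + t)/x = (b - s)/y is a Laurent polynomial, 1 to positive order along `i₁` and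
      -- 0 to positive order along `i₂`; its constant coefficient would be both 1 and 0.
      set g := monomial (-u) * (a + t) with hg
      have hxg : (x : LaurentRing M) * g = a + t := by
        rw [hg, hxc, ← mul_assoc, monomial_mul_monomial_neg, one_mul]
      have hyg : (y : LaurentRing M) * g = b - s := by
        apply mul_left_cancel₀ (monomial_ne_zero u)
        rw [← hxc]
        calc (x : LaurentRing M) * (y * g) = y * (x * g) := by ring
          _ = x * (b - s) := by rw [hxg]; linear_combination -heq
      have c1 : 0 < c i₁ := (hI i₁).2 (Or.inl hi₁)
      have c2 : 0 < c i₂ := (hI i₂).2 (Or.inr hi₂)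
      have g1 : g - 1 ∈ halfSpace (v i₁) (c i₁) := by
        apply hyreg
        have : (y : LaurentRing M) * (g - 1) = (b - y) - s := by
          rw [mul_sub, hyg]; ring
        rw [this]
        exact sub_mem (hb₁ i₁ hi₁) (mem_rankOne.1 hs i₁)
      have g2 : g ∈ halfSpace (v i₂) (c i₂) := by
        apply hyreg
        rw [hyg]
        exact sub_mem (hb₂ i₂ hi₂) (mem_rankOne.1 hs i₂)
      have e1 : coeff 0 (g - 1) = 0 := by
        by_contra h
        have := g1 0 h
        simp only [map_zero] at this
        omega
      have e2 : coeff 0 g = 0 := by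
        by_contra h
        have := g2 0 h
        simp only [map_zero] at this
        omega
      rw [map_sub, e2, ← monomial_zero, coeff_monomial_self] at e1
      norm_num at e1
    intro n
    refine ⟨monomial n * (x * b - y * a), monomial_mul_mem_rankOne.2 hp,
      ⟨monomial n * -(y * e - z * b), monomial_mul_mem_rankOne.2 (neg_mem hzy),
        monomial n * (x * e - z * a), monomial_mul_mem_rankOne.2 hzx, by ring⟩, ?_⟩
    rintro ⟨s, hs, t, ht, heq⟩
    have hinv : ∀ h ∈ rankOne v (c + phiT v n), monomial (-n) * h ∈ rankOne v c := by
      intro h hh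
      refine (monomial_mul_mem_rankOne (m := n)).1 ?_
      rwa [← mul_assoc, monomial_mul_monomial_neg, one_mul]
    refine hcore ⟨_, hinv s hs, _, hinv t ht, ?_⟩
    apply mul_left_cancel₀ (monomial_ne_zero n)
    rw [heq]
    linear_combination (-(x * s : LaurentRing M) - y * t) * monomial_mul_monomial_neg n

end Parameters

/-! ### A regular sequence at the unit of the torus -/

section TorusPoint

open LaurentRing

variable {M : Type u} [AddCommGroup M]

namespace LaurentRing

/-- The algebra map of Laurent polynomial rings induced by an additive map of lattices. -/
def map {M' : Type*} [AddCommGroup M'] (f : M →+ M') : LaurentRing M →ₐ[ℂ] LaurentRing M' :=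
  AddMonoidAlgebra.mapDomainAlgHom ℂ ℂ f

lemma map_monomial {M' : Type*} [AddCommGroup M'] (f : M →+ M') (m : M) :
    map f (monomial m) = monomial (f m) :=
  AddMonoidAlgebra.mapDomain_single

lemma algHom_eq_of_monomial {A : Type*} [Semiring A] [Algebra ℂ A] {f g : LaurentRing M →ₐ[ℂ] A}
    (h : ∀ m, f (monomial m) = g (monomial m)) : f = g := by
  ext x
  rw [eq_sum x, map_sum, map_sum]
  exact Finset.sum_congr rfl fun m _ => by rw [map_smul, map_smul, h]

/-- The evaluation of Laurent polynomials at the unit of the torus. -/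
def evalOne : LaurentRing M →ₐ[ℂ] ℂ :=
  AddMonoidAlgebra.lift ℂ ℂ M 1

lemma evalOne_monomial (m : M) : evalOne (monomial m) = 1 := by
  refine (AddMonoidAlgebra.lift_single (R := ℂ) (A := ℂ) (1 : Multiplicative M →* ℂ) m 1).trans ?_
  simp

variable (B : Module.Basis (Fin 3) ℤ M)

/-- The lattice endomorphism that kills the `i`-th basis vector. -/
def killHom (i : Fin 3) : M →+ M := (LinearMap.id - (B.coord i).smulRight (B i)).toAddMonoidHom

lemma killHom_apply (i : Fin 3) (m : M) : killHom B i m = m - B.repr m i • B i := rfl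

lemma killHom_self (i : Fin 3) : killHom B i (B i) = 0 := by simp [killHom_apply]

lemma killHom_ne {i j : Fin 3} (h : j ≠ i) : killHom B i (B j) = B j := by
  simp [killHom_apply, Finsupp.single_eq_of_ne' h]

/-- The endomorphism of the Laurent polynomial ring that sets the `i`-th variable to one. -/
def kill (i : Fin 3) : LaurentRing M →ₐ[ℂ] LaurentRing M := map (killHom B i)

lemma monomial_zsmul_sub_one_dvd (m : M) (n : ℤ) :
    monomial m - 1 ∣ monomial (n • m) - (1 : LaurentRing M) := by
  obtain ⟨n, rfl | rfl⟩ := n.eq_nat_or_neg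
  · rw [natCast_zsmul, monomial_nsmul]
    exact sub_one_dvd_pow_sub_one _ _
  · have : monomial (-(n : ℤ) • m) - 1 = -monomial (-(n : ℤ) • m) * (monomial (n • m) - 1) := by
      rw [neg_smul, natCast_zsmul]
      linear_combination monomial_neg_mul_monomial (n • m)
    rw [this, monomial_nsmul]
    exact dvd_mul_of_dvd_right (sub_one_dvd_pow_sub_one _ _) _

/-- Killing the i-th basis vector removes from a monomial a power of `monomial (B i)`, which is 1
modulo `monomial (B i) - 1`. -/
lemma dvd_sub_kill (i : Fin 3) (h : LaurentRing M) : monomial (B i) - 1 ∣ h - kill B i h := by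
  rw [eq_sum h, map_sum, ← Finset.sum_sub_distrib]
  refine Finset.dvd_sum fun m _ => ?_
  rw [map_smul, ← smul_sub, Algebra.smul_def]
  refine dvd_mul_of_dvd_right ?_ _
  have h1 : kill B i (monomial m) = monomial (m - B.repr m i • B i) := map_monomial _ _
  have h2 : monomial m = monomial (m - B.repr m i • B i) * monomial (B.repr m i • B i) := by
    rw [← monomial_add, sub_add_cancel]
  rw [h1]
  conv_rhs => rw [h2]
  rw [← mul_sub_one]
  exact dvd_mul_of_dvd_right (monomial_zsmul_sub_one_dvd _ _) _

lemma kill_self (i : Fin 3) : kill B i (monomial (B i)) = 1 := by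
  rw [kill, map_monomial, killHom_self, monomial_zero]

lemma kill_ne {i j : Fin 3} (h : j ≠ i) : kill B i (monomial (B j)) = monomial (B j) := by
  rw [kill, map_monomial, killHom_ne B h]

lemma monomial_sub_one_ne_zero (i : Fin 3) : monomial (B i) - (1 : LaurentRing M) ≠ 0 := fun h =>
  B.ne_zero i (monomial_injective ((sub_eq_zero.1 h).trans monomial_zero.symm))

lemma kill_kill_kill (h : LaurentRing M) :
    kill B 2 (kill B 1 (kill B 0 h)) = algebraMap ℂ _ (evalOne h) := by
  have : ((kill B 2).comp ((kill B 1).comp (kill B 0))) =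
      (Algebra.ofId ℂ (LaurentRing M)).comp evalOne := by
    refine algHom_eq_of_monomial fun m => ?_
    simp only [AlgHom.comp_apply, evalOne_monomial, map_one]
    rw [kill, kill, kill, map_monomial, map_monomial, map_monomial, ← monomial_zero]
    congr 1
    apply B.ext_elem
    intro j
    fin_cases j <;> simp [killHom_apply]
  exact congrArg (fun f => f h) this

end LaurentRing

variable {k : ℕ} {v : Fin k → Module.Dual ℤ M}

/-- Some basis of the lattice starts with an interior vector of the dual cone. -/
lemma IsRaySystem.exists_basis [Module.Free ℤ M] [Module.Finite ℤ M] (hv : IsRaySystem v)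
    (hM : Module.finrank ℤ M = 3) :
    ∃ B : Module.Basis (Fin 3) ℤ M, ∀ l, 0 < v l (B 0) := by
  obtain ⟨u, hu⟩ := hv.exists_interior hM
  have hk : 3 ≤ k := hM ▸ hv.finrank_le
  have hu0 : u ≠ 0 := by
    rintro rfl
    simpa using hu ⟨0, by omega⟩
  -- The Smith normal form of ℤu yields a basis vector on the line through `u`. It is moved to index
  -- 0, and the whole basis is negated if that vector points away from `u`.
  obtain ⟨n, S⟩ := Submodule.smithNormalForm (Module.finBasisOfFinrankEq ℤ M hM)
    (Submodule.span ℤ {u})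
  have hn : Nonempty (Fin n) := by
    by_contra hcon
    rw [not_nonempty_iff] at hcon
    have := S.bN.repr.injective.subsingleton
    exact hu0 (congrArg Subtype.val
      (Subsingleton.elim (⟨u, Submodule.mem_span_singleton_self u⟩ : Submodule.span ℤ {u}) 0))
  obtain ⟨i⟩ := hn
  obtain ⟨s, hs⟩ := Submodule.mem_span_singleton.1 (S.bN i).2
  have hs0 : s ≠ 0 := by
    rintro rfl
    rw [zero_smul] at hs
    exact S.bN.ne_zero i (Subtype.ext hs.symm)
  rw [S.snf i] at hs
  have key : ∀ l, s * v l u = S.a i * v l (S.bM (S.f i)) := fun l => by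
    have := congrArg (v l) hs
    simpa using this
  let B₁ := S.bM.reindex (Equiv.swap (S.f i) 0)
  have hB₁ : B₁ 0 = S.bM (S.f i) := by simp [B₁]
  rcases lt_or_gt_of_ne hs0 with hs' | hs' <;> rcases le_total 0 (S.a i) with ha | ha
  · refine ⟨B₁.unitsSMul fun _ => -1, fun l => ?_⟩
    rw [Module.Basis.unitsSMul_apply, hB₁, Units.neg_smul, one_smul, map_neg]
    have h1 := mul_neg_of_neg_of_pos hs' (hu l)
    have h2 := key l
    by_contra! h3
    have := mul_nonneg ha (by linarith : 0 ≤ v l (S.bM (S.f i)))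
    linarith
  · refine ⟨B₁, fun l => ?_⟩
    rw [hB₁]
    have h1 := mul_neg_of_neg_of_pos hs' (hu l)
    have h2 := key l
    by_contra! h3
    have := mul_nonneg_of_nonpos_of_nonpos ha h3
    linarith
  · refine ⟨B₁, fun l => ?_⟩
    rw [hB₁]
    have h1 := mul_pos hs' (hu l)
    have h2 := key l
    by_contra! h3
    have := mul_nonpos_of_nonneg_of_nonpos ha h3
    linarith
  · refine ⟨B₁.unitsSMul fun _ => -1, fun l => ?_⟩
    rw [Module.Basis.unitsSMul_apply, hB₁, Units.neg_smul, one_smul, map_neg]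
    have h1 := mul_pos hs' (hu l)
    have h2 := key l
    by_contra! h3
    have := mul_nonpos_of_nonpos_of_nonneg ha (by linarith : 0 ≤ v l (S.bM (S.f i)))
    linarith

section Saturation

variable [Module.Free ℤ M] [Module.Finite ℤ M] {w : M} (hw : ∀ l, 0 < v l w)

include hw

lemma eventually_monomial_pow_mul_mem (b : Fin k → ℤ) (h : LaurentRing M) :
    ∀ᶠ K : ℕ in Filter.atTop, monomial w ^ K * h ∈ rankOne v b := by
  obtain ⟨K₀, hK₀⟩ := exists_nsmul_ge hw fun i => ∑ m ∈ h.supp, |b i - v i m|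
  filter_upwards [Filter.eventually_ge_atTop K₀] with K hK
  rw [mem_rankOne, ← monomial_nsmul]
  intro i n hn
  rw [coeff_monomial_mul] at hn
  have h1 := Finset.single_le_sum (f := fun m => |b i - v i m|) (fun _ _ => abs_nonneg _)
    (mem_supp.2 hn)
  have h2 := hK₀ i
  have h3 : v i (K₀ • w) ≤ v i (K • w) := by
    rw [map_nsmul, map_nsmul]
    exact nsmul_le_nsmul_left (hw i).le hK
  have h4 := le_abs_self (b i - v i (n - K • w))
  rw [map_sub] at h1 h4
  linarith

/-- Membership in an ideal containing `x^w - 1`, with `w` interior, can be tested with coefficients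
in `T(b)`. -/
lemma exists_combination_mem {b : Fin k → ℤ} {t f g s r q : LaurentRing M} (ht : t ∈ rankOne v b)
    (h : t = (monomial w - 1) * s + f * r + g * q) :
    ∃ s' ∈ rankOne v b, ∃ r' ∈ rankOne v b, ∃ q' ∈ rankOne v b,
      t = (monomial w - 1) * s' + f * r' + g * q' ∧ (r = 0 → r' = 0) ∧ (q = 0 → q' = 0) := by
  obtain ⟨K, h1, h2, h3⟩ := ((eventually_monomial_pow_mul_mem hw b s).and
    ((eventually_monomial_pow_mul_mem hw b r).and
      (eventually_monomial_pow_mul_mem hw b q))).exists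
  have hw' : monomial w ∈ toricRing v := monomial_mem_toricRing.2 fun i => (hw i).le
  have hG : ∑ i ∈ Finset.range K, monomial w ^ i ∈ toricRing v :=
    Subalgebra.sum_mem _ fun i _ => pow_mem hw' i
  -- Multiplication by `monomial w ^ K` carries all coefficients into T(b); the error `(monomial w ^
  -- K - 1) * t` is a geometric sum times `monomial w - 1` and is absorbed into the first
  -- coefficient.
  refine ⟨monomial w ^ K * s - (∑ i ∈ Finset.range K, monomial w ^ i) * t,
    sub_mem h1 (toricRing_mul_mem_rankOne hG ht), _, h2, _, h3, ?_, fun h => by simp [h],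
    fun h => by simp [h]⟩
  have h4 := geom_sum_mul (monomial w : LaurentRing M) K
  linear_combination (monomial w ^ K) * h + t * h4

end Saturation

/-- The unit of the torus is cut out by a sequence of three elements of the toric ring that is
regular on all modules `T(b)`; it also provides a chain of prime ideals. -/
theorem IsRaySystem.exists_torus_sequence [Module.Free ℤ M] [Module.Finite ℤ M]
    (hv : IsRaySystem v) (hM : Module.finrank ℤ M = 3) :
    3 ≤ ringKrullDim (toricRing v) ∧ ∃ x y z : toricRing v, x ≠ 0 ∧
      (∀ b, ∀ t ∈ rankOne v b, ∀ s ∈ rankOne v b, (y : LaurentRing M) * t = x * s →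
        ∃ t' ∈ rankOne v b, t = x * t') ∧
      (∀ b, ∀ t ∈ rankOne v b, ∀ s ∈ rankOne v b, ∀ r ∈ rankOne v b,
        (z : LaurentRing M) * t = x * s + y * r →
        ∃ s' ∈ rankOne v b, ∃ r' ∈ rankOne v b, t = x * s' + y * r') ∧
      evalOne (x : LaurentRing M) = 0 ∧ evalOne (y : LaurentRing M) = 0 ∧
      evalOne (z : LaurentRing M) = 0 ∧
      (∀ b, ∀ t ∈ rankOne v b, evalOne t = 0 → ∃ s ∈ rankOne v b, ∃ r ∈ rankOne v b,
        ∃ q ∈ rankOne v b, t = x * s + y * r + z * q) := by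
  obtain ⟨B, hB⟩ := hv.exists_basis hM
  -- Shifting by `N • B 0` moves the other basis vectors into the dual cone, so `y` and `z` are
  -- `monomial (B 1) - 1` and `monomial (B 2) - 1` up to a unit of ℂ[M], yet lie in R.
  obtain ⟨N, hN1, hN2⟩ : ∃ N : ℕ, (∀ i, 0 ≤ v i (N • B 0 + B 1)) ∧
      ∀ i, 0 ≤ v i (N • B 0 + B 2) := by
    obtain ⟨N, hN⟩ := exists_nsmul_ge hB fun i => |v i (B 1)| + |v i (B 2)|
    refine ⟨N, fun i => ?_, fun i => ?_⟩ <;>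
    · rw [map_add]
      have h1 := hN i
      have h2 := neg_abs_le (v i (B 1))
      have h3 := neg_abs_le (v i (B 2))
      have h4 := abs_nonneg (v i (B 1))
      have h5 := abs_nonneg (v i (B 2))
      linarith
  have hN0 : ∀ i, 0 ≤ v i (N • B 0) := fun i => by
    rw [map_nsmul]; exact nsmul_nonneg (hB i).le _
  let x : toricRing v := toricMonomial v (B 0) (fun i => (hB i).le) - 1
  let y : toricRing v := toricMonomial v _ hN1 - toricMonomial v _ hN0
  let z : toricRing v := toricMonomial v _ hN2 - toricMonomial v _ hN0
  have hx : (x : LaurentRing M) = monomial (B 0) - 1 := rfl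
  have hy : (y : LaurentRing M) = monomial (N • B 0) * (monomial (B 1) - 1) := by
    rw [mul_sub_one, ← monomial_add]; rfl
  have hz : (z : LaurentRing M) = monomial (N • B 0) * (monomial (B 2) - 1) := by
    rw [mul_sub_one, ← monomial_add]; rfl
  have k0N : kill B 0 (monomial (N • B 0)) = 1 := by
    rw [monomial_nsmul, map_pow, kill_self, one_pow]
  have k0x : kill B 0 (x : LaurentRing M) = 0 := by rw [hx, map_sub, kill_self, map_one (kill B _), sub_self]
  have k0y : kill B 0 (y : LaurentRing M) = monomial (B 1) - 1 := by
    rw [hy, map_mul, k0N, one_mul, map_sub, kill_ne B (by decide), map_one (kill B 0)]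
  have k0z : kill B 0 (z : LaurentRing M) = monomial (B 2) - 1 := by
    rw [hz, map_mul, k0N, one_mul, map_sub, kill_ne B (by decide), map_one (kill B 0)]
  have k1y : kill B 1 (kill B 0 (y : LaurentRing M)) = 0 := by
    rw [k0y, map_sub, kill_self, map_one (kill B _), sub_self]
  have k1z : kill B 1 (kill B 0 (z : LaurentRing M)) = monomial (B 2) - 1 := by
    rw [k0z, map_sub, kill_ne B (by decide), map_one (kill B 1)]
  have k2z : kill B 2 (kill B 1 (kill B 0 (z : LaurentRing M))) = 0 := by
    rw [k1z, map_sub, kill_self, map_one (kill B _), sub_self]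
  have hyinv : ∀ h : LaurentRing M, (monomial (B 1) - 1) * h = y * (monomial (-(N • B 0)) * h) := by
    intro h
    rw [hy]
    linear_combination (-(monomial (B 1) - 1) * h) * monomial_mul_monomial_neg (N • B 0)
  have hzinv : ∀ h : LaurentRing M, (monomial (B 2) - 1) * h = z * (monomial (-(N • B 0)) * h) := by
    intro h
    rw [hz]
    linear_combination (-(monomial (B 2) - 1) * h) * monomial_mul_monomial_neg (N • B 0)
  refine ⟨?_, x, y, z, ?_, ?_, ?_, ?_, ?_, ?_, ?_⟩
  -- Setting the variables to 1 one after another gives four prime kernels; `x`, `y`, `z` show the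
  -- inclusions to be strict.
  · let P : Fin 4 → (LaurentRing M →ₐ[ℂ] LaurentRing M) :=
      ![AlgHom.id ℂ _, kill B 0, (kill B 1).comp (kill B 0),
        (kill B 2).comp ((kill B 1).comp (kill B 0))]
    let p : Fin 4 → PrimeSpectrum (toricRing v) := fun s =>
      ⟨RingHom.ker ((P s).comp (toricRing v).val), RingHom.ker_isPrime _⟩
    have hmono : StrictMono p := by
      rw [Fin.strictMono_iff_lt_succ]
      intro s
      refine lt_of_le_of_ne ?_ ?_
      · intro f hf
        change P s.succ f = 0
        replace hf : P s.castSucc f = 0 := hf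
        fin_cases s
        · exact (congrArg (kill B 0) hf).trans (map_zero _)
        · exact (congrArg (kill B 1) hf).trans (map_zero _)
        · exact (congrArg (kill B 2) hf).trans (map_zero _)
      · intro heq
        have key : ∀ f : toricRing v, P s.succ f = 0 → P s.castSucc f = 0 := fun f hf => by
          have : f ∈ (p s.succ).asIdeal := hf
          rw [← heq] at this
          exact this
        fin_cases s
        · exact monomial_sub_one_ne_zero B 0 (key x k0x)
        · exact monomial_sub_one_ne_zero B 1 (k0y.symm.trans (key y k1y))
        · exact monomial_sub_one_ne_zero B 2 (k1z.symm.trans (key z k2z))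
    exact Order.LTSeries.length_le_krullDim (LTSeries.mk 3 p hmono)
  · exact fun h => monomial_sub_one_ne_zero B 0 (congrArg Subtype.val h)
  -- Setting the first variable to 1 leaves an equation in a domain, so `t` is divisible by `x` in
  -- ℂ[M]; `exists_combination_mem` brings the quotient back into T(b). The next clause argues
  -- likewise with two variables.
  · intro b t ht s hs h
    have h0 : kill B 0 t = 0 := by
      have := congrArg (kill B 0) h
      rw [map_mul, map_mul, k0x, zero_mul, k0y] at this
      exact (mul_eq_zero.1 this).resolve_left (monomial_sub_one_ne_zero B 1)
    obtain ⟨g, hg⟩ := dvd_sub_kill B 0 t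
    rw [h0, sub_zero] at hg
    obtain ⟨s', hs', r', -, q', -, h1, h2, h3⟩ :=
      exists_combination_mem hB (f := 0) (g := 0) (s := g) (r := 0) (q := 0) ht (by simpa using hg)
    exact ⟨s', hs', by simpa [hx] using h1⟩
  · intro b t ht s hs r hr h
    have h0 : kill B 1 (kill B 0 t) = 0 := by
      have := congrArg (fun a => kill B 1 (kill B 0 a)) h
      simp only [map_mul, map_add, k0x, k1y, k1z, map_zero, zero_mul, add_zero] at this
      exact (mul_eq_zero.1 this).resolve_left (monomial_sub_one_ne_zero B 2)
    obtain ⟨g, hg⟩ := dvd_sub_kill B 0 t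
    obtain ⟨g', hg'⟩ := dvd_sub_kill B 1 (kill B 0 t)
    rw [h0, sub_zero] at hg'
    rw [hg', hyinv] at hg
    obtain ⟨s', hs', r', hr', q', -, h1, h2, h3⟩ :=
      exists_combination_mem hB (f := y) (g := 0) (s := g)
        (r := monomial (-(N • B 0)) * g') (q := 0) ht
        (by rw [zero_mul, add_zero]; exact sub_eq_iff_eq_add.1 hg)
    exact ⟨s', hs', r', hr', by simpa [hx] using h1⟩
  · rw [hx, map_sub, evalOne_monomial, map_one, sub_self]
  · rw [hy, map_mul, map_sub, evalOne_monomial (B 1), map_one, sub_self, mul_zero]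
  · rw [hz, map_mul, map_sub, evalOne_monomial (B 2), map_one, sub_self, mul_zero]
  · intro b t ht h
    have h0 : kill B 2 (kill B 1 (kill B 0 t)) = 0 := by rw [kill_kill_kill, h, map_zero]
    obtain ⟨g, hg⟩ := dvd_sub_kill B 0 t
    obtain ⟨g', hg'⟩ := dvd_sub_kill B 1 (kill B 0 t)
    obtain ⟨g'', hg''⟩ := dvd_sub_kill B 2 (kill B 1 (kill B 0 t))
    rw [h0, sub_zero, hzinv] at hg''
    rw [hyinv] at hg'
    obtain ⟨s', hs', r', hr', q', hq', h1, -, -⟩ :=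
      exists_combination_mem hB (f := y) (g := z) (s := g)
        (r := monomial (-(N • B 0)) * g') (q := monomial (-(N • B 0)) * g'') ht
        (by linear_combination hg + hg' + hg'')
    exact ⟨s', hs', r', hr', q', hq', h1⟩

end TorusPoint

/-! ### Projective dimension, Ext and regular sequences -/

section Homological

open CategoryTheory CategoryTheory.Abelian

section Sequences

variable {A : Type u} [Ring A]

lemma shortExact_of_linearMap {X Y Z : Type u} [AddCommGroup X] [AddCommGroup Y] [AddCommGroup Z]
    [Module A X] [Module A Y] [Module A Z] (f : X →ₗ[A] Y) (g : Y →ₗ[A] Z)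
    (hf : Function.Injective f) (hfg : Function.Exact f g) (hg : Function.Surjective g) :
    (ModuleCat.shortComplexOfCompEqZero f g hfg.linearMap_comp_eq_zero).ShortExact :=
  ModuleCat.shortComplex_shortExact _ hfg hf hg

lemma shortExact_submodule {X : Type u} [AddCommGroup X] [Module A X] (N : Submodule A X) :
    (ModuleCat.shortComplexOfCompEqZero N.subtype N.mkQ
      (LinearMap.exact_subtype_mkQ N).linearMap_comp_eq_zero).ShortExact :=
  shortExact_of_linearMap _ _ N.injective_subtype (LinearMap.exact_subtype_mkQ N) N.mkQ_surjective

lemma shortExact_ker_range {X Y : Type u} [AddCommGroup X] [Module A X] [AddCommGroup Y]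
    [Module A Y] (f : X →ₗ[A] Y) :
    (LinearMap.shortComplexKer f.rangeRestrict).ShortExact :=
  LinearMap.shortExact_shortComplexKer f.surjective_rangeRestrict

lemma isFiniteLength_of_le {X : Type u} [AddCommGroup X] [Module A X] (h : IsFiniteLength A X)
    (N : Submodule A X) : IsFiniteLength A N ∧ IsFiniteLength A (X ⧸ N) := by
  obtain ⟨_, _⟩ := isFiniteLength_iff_isNoetherian_isArtinian.1 h
  exact ⟨isFiniteLength_iff_isNoetherian_isArtinian.2 ⟨inferInstance, inferInstance⟩,
    isFiniteLength_iff_isNoetherian_isArtinian.2 ⟨inferInstance, inferInstance⟩⟩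

/-- Modules of finite length have projective dimension less than `n` if all simple ones do. -/
lemma hasProjectiveDimensionLT_of_isFiniteLength {n : ℕ}
    (hs : ∀ (S : Type u) [AddCommGroup S] [Module A S], IsSimpleModule A S →
      HasProjectiveDimensionLT (ModuleCat.of A S) n)
    (X : Type u) [AddCommGroup X] [Module A X] (hX : IsFiniteLength A X) :
    HasProjectiveDimensionLT (ModuleCat.of A X) n := by
  induction hX with
  | @of_subsingleton X _ _ _ =>
    have : HasProjectiveDimensionLT (ModuleCat.of A X) 0 :=
      (ModuleCat.isZero_of_subsingleton _).hasProjectiveDimensionLT_zero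
    exact hasProjectiveDimensionLT_of_ge _ 0 n (Nat.zero_le n)
  | @of_simple_quotient X _ _ N hN _ ih =>
    exact (shortExact_submodule N).hasProjectiveDimensionLT_X₂ n ih (hs _ hN)

/-- Suppose that all simple modules have projective dimension `n + 1`. If an endomorphism of a
module of projective dimension at most `n` has kernel and cokernel of finite length, then it is
injective. -/
theorem ker_eq_bot_of_isFiniteLength {n : ℕ}
    (hs : ∀ (S : Type u) [AddCommGroup S] [Module A S], IsSimpleModule A S →
      HasProjectiveDimensionLT (ModuleCat.of A S) (n + 2) ∧
        ¬ HasProjectiveDimensionLT (ModuleCat.of A S) (n + 1))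
    {X : Type u} [AddCommGroup X] [Module A X]
    (hX : HasProjectiveDimensionLT (ModuleCat.of A X) (n + 1)) (φ : X →ₗ[A] X)
    (hker : IsFiniteLength A (LinearMap.ker φ))
    (hcoker : IsFiniteLength A (X ⧸ LinearMap.range φ)) : LinearMap.ker φ = ⊥ := by
  have hfl := fun (Y : Type u) [AddCommGroup Y] [Module A Y] (hY : IsFiniteLength A Y) =>
    hasProjectiveDimensionLT_of_isFiniteLength (fun S _ _ hS => (hs S hS).1) Y hY
  -- The cokernel has projective dimension at most `n + 1` and `X` at most `n`, so the image, and
  -- then the kernel, has at most `n`.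
  have h1 : HasProjectiveDimensionLT (ModuleCat.of A (LinearMap.range φ)) (n + 1) :=
    (shortExact_submodule (LinearMap.range φ)).hasProjectiveDimensionLT_X₁ (n + 1) hX
      (hfl _ hcoker)
  have h2 : HasProjectiveDimensionLT (ModuleCat.of A (LinearMap.ker φ.rangeRestrict)) (n + 1) :=
    (shortExact_ker_range φ).hasProjectiveDimensionLT_X₁ (n + 1) hX
      (hasProjectiveDimensionLT_of_ge _ (n + 1) _ (Nat.le_succ _))
  rw [LinearMap.ker_rangeRestrict] at h2
  by_contra hne
  obtain ⟨_, _⟩ := isFiniteLength_iff_isNoetherian_isArtinian.1 hker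
  have : Nontrivial (LinearMap.ker φ) := Submodule.nontrivial_iff_ne_bot.2 hne
  obtain ⟨S, hS⟩ := IsAtomic.exists_atom (Submodule A (LinearMap.ker φ))
  have hS' : IsSimpleModule A S := isSimpleModule_iff_isAtom.2 hS
  -- The quotient of the kernel by `S` has finite length, hence projective dimension at most `n +
  -- 1`; this would leave at most `n` for `S`.
  exact (hs S hS').2 ((shortExact_submodule S).hasProjectiveDimensionLT_X₁ (n + 1) h2
    (hfl _ (isFiniteLength_of_le hker S).2))

end Sequences

section RegularStep

variable {R : Type u} [CommRing R] {A : Type u} [Ring A] [Algebra R A]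
  {P : Type u} [AddCommGroup P] [Module R P] [Module A P] [IsScalarTower R A P]

/-- The element `r` is regular on `P ⧸ N`, and `N' = N + r P`. -/
structure IsRegularStep (r : R) (N N' : Submodule A P) : Prop where
  le : N ≤ N'
  smul_mem : ∀ p, r • p ∈ N'
  exists_add : ∀ p ∈ N', ∃ n ∈ N, ∃ q, p = n + r • q
  mem_of_smul_mem : ∀ p, r • p ∈ N → p ∈ N

variable {r : R} {N N' : Submodule A P}

/-- Multiplication by a central element as a linear endomorphism. -/
def mulEnd (A : Type u) [Ring A] [Algebra R A] (X : Type u) [AddCommGroup X] [Module R X]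
    [Module A X] [IsScalarTower R A X] (r : R) : X →ₗ[A] X where
  toFun p := r • p
  map_add' := smul_add r
  map_smul' a p := smul_comm r a p

lemma IsRegularStep.injective (h : IsRegularStep r N N') :
    Function.Injective (mulEnd A (P ⧸ N) r) := by
  rw [← LinearMap.ker_eq_bot, LinearMap.ker_eq_bot']
  intro q
  obtain ⟨p, rfl⟩ := N.mkQ_surjective q
  intro hp
  exact (Submodule.Quotient.mk_eq_zero N).2
    (h.mem_of_smul_mem p ((Submodule.Quotient.mk_eq_zero N).1 hp))

lemma IsRegularStep.exact (h : IsRegularStep r N N') :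
    Function.Exact (mulEnd A (P ⧸ N) r) (Submodule.factor h.le) := by
  intro q
  obtain ⟨p, rfl⟩ := N.mkQ_surjective q
  constructor
  · intro hp
    obtain ⟨n, hn, q, rfl⟩ := h.exists_add p ((Submodule.Quotient.mk_eq_zero N').1 hp)
    refine ⟨N.mkQ q, ?_⟩
    have hn' : N.mkQ n = 0 := (Submodule.Quotient.mk_eq_zero N).2 hn
    rw [map_add, hn', zero_add]
    rfl
  · rintro ⟨q, hq⟩
    obtain ⟨q, rfl⟩ := N.mkQ_surjective q
    rw [← hq]
    exact (Submodule.Quotient.mk_eq_zero N').2 (h.smul_mem q)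

lemma IsRegularStep.shortExact (h : IsRegularStep r N N') :
    (ModuleCat.shortComplexOfCompEqZero (mulEnd A (P ⧸ N) r) (Submodule.factor h.le)
      h.exact.linearMap_comp_eq_zero).ShortExact :=
  shortExact_of_linearMap _ _ h.injective h.exact (Submodule.factor_surjective h.le)

lemma IsRegularStep.hasProjectiveDimensionLT (h : IsRegularStep r N N') {n : ℕ}
    (hN : HasProjectiveDimensionLT (ModuleCat.of A (P ⧸ N)) n) :
    HasProjectiveDimensionLT (ModuleCat.of A (P ⧸ N')) (n + 1) :=
  h.shortExact.hasProjectiveDimensionLT_X₃ n hN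
    (hasProjectiveDimensionLT_of_ge _ n _ (Nat.le_succ _))

open scoped ModuleCat.Algebra in
-- A central element acts on Ext in the same way through either argument, and it acts as zero on
-- `S`.
lemma mk₀_comp_eq_zero_of_central {X S : ModuleCat.{u} A} (f : X ⟶ X)
    (hf : ∀ p : X, f.hom p = algebraMap R A r • p) (hr : ∀ s : S, algebraMap R A r • s = 0) {n : ℕ}
    (e : Ext X S n) : (Ext.mk₀ f).comp e (zero_add n) = 0 := by
  have h1 : f = r • 𝟙 X := by
    ext p
    exact hf p
  have h2 : r • 𝟙 S = (0 : S ⟶ S) := by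
    ext s
    exact hr s
  rw [h1, Ext.mk₀_smul, Ext.smul_comp, Ext.mk₀_id_comp, Ext.smul_eq_comp_mk₀, h2, Ext.mk₀_zero,
    Ext.comp_zero]

/-- If `r` annihilates `S`, the vanishing of `Ext^(n+1)(P ⧸ N', S)` implies that of
`Ext^n(P ⧸ N, S)`. -/
lemma IsRegularStep.subsingleton_ext (h : IsRegularStep r N N') {n : ℕ} {S : ModuleCat.{u} A}
    (hr : ∀ s : S, algebraMap R A r • s = 0)
    (hN' : Subsingleton (Ext (ModuleCat.of A (P ⧸ N')) S (n + 1))) :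
    Subsingleton (Ext (ModuleCat.of A (P ⧸ N)) S n) := by
  refine subsingleton_of_forall_eq 0 fun e => ?_
  -- The class `e` maps to zero in `Ext^(n+1)(P ⧸ N', S)`, so it comes from `e'` by multiplication
  -- by `r`, which is zero.
  obtain ⟨e', he'⟩ := Ext.contravariant_sequence_exact₁ h.shortExact S e (add_comm 1 n)
    (Subsingleton.elim (α := Ext (ModuleCat.of A (P ⧸ N')) S (n + 1)) _ _)
  rw [← he']
  exact mk₀_comp_eq_zero_of_central _ (fun p => (algebraMap_smul A r (p : P ⧸ N)).symm) hr e'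

/-- The vanishing of `Ext^n(F, P ⧸ N)` and `Ext^(n+1)(F, P ⧸ N)` implies that of
`Ext^n(F, P ⧸ N')`. -/
lemma IsRegularStep.subsingleton_ext_right (h : IsRegularStep r N N') {n : ℕ} {F : ModuleCat.{u} A}
    (h₀ : Subsingleton (Ext F (ModuleCat.of A (P ⧸ N)) n))
    (h₁ : Subsingleton (Ext F (ModuleCat.of A (P ⧸ N)) (n + 1))) :
    Subsingleton (Ext F (ModuleCat.of A (P ⧸ N')) n) := by
  refine subsingleton_of_forall_eq 0 fun e => ?_
  obtain ⟨e', he'⟩ := Ext.covariant_sequence_exact₃ F h.shortExact e rfl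
    (Subsingleton.elim (α := Ext F (ModuleCat.of A (P ⧸ N)) (n + 1)) _ _)
  rw [← he', Subsingleton.elim (α := Ext F (ModuleCat.of A (P ⧸ N)) n) e' 0, Ext.zero_comp]

/-- A module obtained from a projective module by dividing out a regular sequence of length three
has projective dimension three. -/
theorem projectiveDimension_of_isRegularStep [Module.Projective A P] {r₁ r₂ r₃ : R}
    {N₁ N₂ N₃ : Submodule A P} (h₁ : IsRegularStep r₁ ⊥ N₁) (h₂ : IsRegularStep r₂ N₁ N₂)
    (h₃ : IsRegularStep r₃ N₂ N₃) :
    HasProjectiveDimensionLT (ModuleCat.of A (P ⧸ N₃)) 4 ∧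
      (Nontrivial (P ⧸ N₃) → ¬ HasProjectiveDimensionLT (ModuleCat.of A (P ⧸ N₃)) 3) := by
  have hproj : Module.Projective A (P ⧸ (⊥ : Submodule A P)) :=
    Module.Projective.of_equiv (Submodule.quotEquivOfEqBot ⊥ rfl).symm
  have : Projective (ModuleCat.of A (P ⧸ (⊥ : Submodule A P))) :=
    (IsProjective.iff_projective _).1 hproj
  refine ⟨h₃.hasProjectiveDimensionLT (h₂.hasProjectiveDimensionLT
    (h₁.hasProjectiveDimensionLT inferInstance)), fun hnt hlt => ?_⟩
  have hle₂ := h₃.le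
  have hkill : ∀ r : R, (∀ p, r • p ∈ N₃) →
      ∀ s : ModuleCat.of A (P ⧸ N₃), algebraMap R A r • s = 0 := by
    intro r hr s
    obtain ⟨p, rfl⟩ := N₃.mkQ_surjective s
    exact (algebraMap_smul A r _).trans ((Submodule.Quotient.mk_eq_zero N₃).2 (hr p))
  -- If the dimension were at most 2, then `Ext³(P ⧸ N₃, P ⧸ N₃) = 0` would descend step by step to
  -- `Hom(P ⧸ ⊥, P ⧸ N₃) = 0`, contradicting the quotient map.
  have e3 := HasProjectiveDimensionLT.subsingleton (ModuleCat.of A (P ⧸ N₃)) 3 3 le_rfl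
    (ModuleCat.of A (P ⧸ N₃))
  have e2 := h₃.subsingleton_ext (hkill r₃ h₃.smul_mem) e3
  have e1 := h₂.subsingleton_ext (hkill r₂ fun p => h₃.le (h₂.smul_mem p)) e2
  have e0 := h₁.subsingleton_ext (hkill r₁ fun p => h₃.le (h₂.le (h₁.smul_mem p))) e1
  have hzero : ModuleCat.ofHom (Submodule.factor (bot_le : (⊥ : Submodule A P) ≤ N₃)) = 0 :=
    (Ext.homEquiv₀ (X := ModuleCat.of A (P ⧸ (⊥ : Submodule A P)))
      (Y := ModuleCat.of A (P ⧸ N₃))).symm.injective (Subsingleton.elim _ _)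
  obtain ⟨s, hs⟩ := exists_ne (0 : P ⧸ N₃)
  obtain ⟨q, rfl⟩ := Submodule.factor_surjective (bot_le : (⊥ : Submodule A P) ≤ N₃) s
  exact hs (congrArg (fun f => f.hom q) hzero)

end RegularStep

section Killed

variable {R : Type u} [CommRing R]

/-- A Noetherian module annihilated by an ideal with Artinian quotient is Artinian. -/
lemma isArtinian_of_smul_eq_zero {J : Ideal R} [IsArtinianRing (R ⧸ J)] {X : Type u}
    [AddCommGroup X] [Module R X] [Module.Finite R X] (h : ∀ r ∈ J, ∀ p : X, r • p = 0) :
    IsArtinian R X := by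
  have ht : Module.IsTorsionBySet R X (J : Set R) := fun p r => h r.1 r.2 p
  let := ht.module
  have : IsScalarTower R (R ⧸ J) X := ht.isScalarTower
  have : Module.Finite (R ⧸ J) X := Module.Finite.of_restrictScalars_finite R (R ⧸ J) X
  exact isArtinian_of_surjective_algebraMap (R := R ⧸ J) (S := R) Ideal.Quotient.mk_surjective

lemma isFiniteLength_of_smul_eq_zero {J : Ideal R} [IsArtinianRing (R ⧸ J)] {A : Type u} [Ring A]
    [Algebra R A] {X : Type u} [AddCommGroup X] [Module R X] [Module A X] [IsScalarTower R A X]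
    [IsNoetherian R X] (h : ∀ r ∈ J, ∀ p : X, r • p = 0) : IsFiniteLength A X :=
  isFiniteLength_iff_isNoetherian_isArtinian.2
    ⟨isNoetherian_of_tower R inferInstance, isArtinian_of_tower R (isArtinian_of_smul_eq_zero h)⟩

/-- If `I` is the only maximal ideal containing `J`, the vanishing of `Ext^i(R ⧸ I, T)` passes to
modules of finite length annihilated by `J`. -/
lemma subsingleton_ext_of_isFiniteLength {I J : Ideal R}
    (hIJ : ∀ I' : Ideal R, I'.IsMaximal → J ≤ I' → I' = I) {T : ModuleCat.{u} R} {i : ℕ}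
    (hT : Subsingleton (Ext (ModuleCat.of R (R ⧸ I)) T i)) (X : Type u) [AddCommGroup X]
    [Module R X] (hX : IsFiniteLength R X) (h : ∀ r ∈ J, ∀ p : X, r • p = 0) :
    Subsingleton (Ext (ModuleCat.of R X) T i) := by
  induction hX with
  | @of_subsingleton X _ _ _ =>
    have : HasProjectiveDimensionLT (ModuleCat.of R X) 0 :=
      (ModuleCat.isZero_of_subsingleton _).hasProjectiveDimensionLT_zero
    exact HasProjectiveDimensionLT.subsingleton _ 0 i (Nat.zero_le i) T
  | @of_simple_quotient X _ _ N hN _ ih =>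
    have h1 := ih fun r hr p => Subtype.ext (h r hr p)
    -- The simple quotient is `R ⧸ I'` with `I'` maximal and containing `J`, so `I' = I`.
    have h2 : Subsingleton (Ext (ModuleCat.of R (X ⧸ N)) T i) := by
      obtain ⟨I', hI', ⟨e⟩⟩ := isSimpleModule_iff_quot_maximal.1 hN
      have hJ : J ≤ I' := by
        intro r hr
        have h3 : r • e.symm (Ideal.Quotient.mk I' 1) = 0 := by
          obtain ⟨p, hp⟩ := N.mkQ_surjective (e.symm (Ideal.Quotient.mk I' 1))
          rw [← hp, ← map_smul, h r hr, map_zero]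
        rw [← map_smul, LinearEquiv.map_eq_zero_iff] at h3
        have h4 : Ideal.Quotient.mk I' (r * 1) = 0 := h3
        rwa [mul_one, Ideal.Quotient.eq_zero_iff_mem] at h4
      obtain rfl := hIJ I' hI' hJ
      refine subsingleton_of_forall_eq 0 fun x => ?_
      rw [← x.mk₀_id_comp, ← e.toModuleIso.hom_inv_id, ← Ext.mk₀_comp_mk₀,
        Ext.comp_assoc_of_second_deg_zero,
        Subsingleton.elim ((Ext.mk₀ e.toModuleIso.inv).comp x (zero_add i)) 0, Ext.comp_zero]
    refine subsingleton_of_forall_eq 0 fun x => ?_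
    obtain ⟨y, hy⟩ := Ext.contravariant_sequence_exact₂ (shortExact_submodule N) T x
      (Subsingleton.elim (α := Ext (ModuleCat.of R N) T i) _ _)
    rw [← hy, Subsingleton.elim (α := Ext (ModuleCat.of R (X ⧸ N)) T i) y 0, Ext.comp_zero]

end Killed

end Homological

/-! ### Regular sequences on sums of modules T(b), and the Cohen–Macaulay case -/

section Modules

open LaurentRing CategoryTheory CategoryTheory.Abelian

section Steps

variable {R : Type u} [CommRing R] {A : Type u} [Ring A] [Algebra R A]
  {P : Type u} [AddCommGroup P] [Module R P] [Module A P] [IsScalarTower R A P]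

lemma IsRegularStep.sup_range {r : R} {N : Submodule A P} (h : ∀ p, r • p ∈ N → p ∈ N) :
    IsRegularStep r N (N ⊔ LinearMap.range (mulEnd A P r)) where
  le := le_sup_left
  smul_mem p := Submodule.mem_sup_right ⟨p, rfl⟩
  exists_add p hp := by
    obtain ⟨n, hn, _, ⟨q, rfl⟩, rfl⟩ := Submodule.mem_sup.1 hp
    exact ⟨n, hn, q, rfl⟩
  mem_of_smul_mem := h

variable (A P) in
/-- The submodule `x P`. -/
def mulRange₁ (x : R) : Submodule A P := ⊥ ⊔ LinearMap.range (mulEnd A P x)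

variable (A P) in
/-- The submodule `x P + y P`. -/
def mulRange₂ (x y : R) : Submodule A P := mulRange₁ A P x ⊔ LinearMap.range (mulEnd A P y)

variable (A P) in
/-- The submodule `x P + y P + z P`. -/
def mulRange₃ (x y z : R) : Submodule A P := mulRange₂ A P x y ⊔ LinearMap.range (mulEnd A P z)

lemma mem_mulRange₁ {x : R} {p : P} : p ∈ mulRange₁ A P x ↔ ∃ q, p = x • q := by
  rw [mulRange₁, bot_sup_eq]
  exact ⟨fun ⟨q, hq⟩ => ⟨q, hq.symm⟩, fun ⟨q, hq⟩ => ⟨q, hq.symm⟩⟩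

lemma mem_mulRange₂ {x y : R} {p : P} :
    p ∈ mulRange₂ A P x y ↔ ∃ q q', p = x • q + y • q' := by
  rw [mulRange₂, Submodule.mem_sup]
  constructor
  · rintro ⟨a, ha, _, ⟨q', rfl⟩, rfl⟩
    obtain ⟨q, rfl⟩ := mem_mulRange₁.1 ha
    exact ⟨q, q', rfl⟩
  · rintro ⟨q, q', rfl⟩
    exact ⟨_, mem_mulRange₁.2 ⟨q, rfl⟩, _, ⟨q', rfl⟩, rfl⟩

lemma mem_mulRange₃ {x y z : R} {p : P} :
    p ∈ mulRange₃ A P x y z ↔ ∃ q q' q'', p = x • q + y • q' + z • q'' := by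
  rw [mulRange₃, Submodule.mem_sup]
  constructor
  · rintro ⟨a, ha, _, ⟨q'', rfl⟩, rfl⟩
    obtain ⟨q, q', rfl⟩ := mem_mulRange₂.1 ha
    exact ⟨q, q', q'', rfl⟩
  · rintro ⟨q, q', q'', rfl⟩
    exact ⟨_, mem_mulRange₂.2 ⟨q, q', rfl⟩, _, ⟨q'', rfl⟩, rfl⟩

/-- The kernel and the cokernel of the multiplication by `z` on `P ⧸ (x P + y P)` are annihilated
by the ideal `(x, y, z)`. -/
lemma span_smul_eq_zero {x y z r : R} (hr : r ∈ Ideal.span {x, y, z}) :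
    (∀ q : LinearMap.ker (mulEnd A (P ⧸ mulRange₂ A P x y) z), r • q = 0) ∧
      ∀ q : (P ⧸ mulRange₂ A P x y) ⧸ LinearMap.range (mulEnd A (P ⧸ mulRange₂ A P x y) z),
        r • q = 0 := by
  have hx : ∀ q : P ⧸ mulRange₂ A P x y, x • q = 0 := fun q => by
    obtain ⟨p, rfl⟩ := Submodule.mkQ_surjective _ q
    exact (Submodule.Quotient.mk_eq_zero _).2 (mem_mulRange₂.2 ⟨p, 0, by simp⟩)
  have hy : ∀ q : P ⧸ mulRange₂ A P x y, y • q = 0 := fun q => by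
    obtain ⟨p, rfl⟩ := Submodule.mkQ_surjective _ q
    exact (Submodule.Quotient.mk_eq_zero _).2 (mem_mulRange₂.2 ⟨0, p, by simp⟩)
  induction hr using Submodule.span_induction with
  | mem r hr =>
    rcases hr with rfl | rfl | rfl
    · refine ⟨fun q => Subtype.ext (hx q), fun q => ?_⟩
      obtain ⟨p, rfl⟩ := Submodule.mkQ_surjective _ q
      exact (Submodule.Quotient.mk_eq_zero _).2 (by
        change r • _ ∈ _
        rw [hx]
        exact zero_mem _)
    · refine ⟨fun q => Subtype.ext (hy q), fun q => ?_⟩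
      obtain ⟨p, rfl⟩ := Submodule.mkQ_surjective _ q
      exact (Submodule.Quotient.mk_eq_zero _).2 (by
        change r • _ ∈ _
        rw [hy]
        exact zero_mem _)
    · refine ⟨fun q => Subtype.ext q.2, fun q => ?_⟩
      obtain ⟨p, rfl⟩ := Submodule.mkQ_surjective _ q
      exact (Submodule.Quotient.mk_eq_zero _).2 ⟨p, rfl⟩
  | zero => simp
  | add a b _ _ ha hb => simp [add_smul, ha.1, ha.2, hb.1, hb.2]
  | smul a b _ hb => simp [mul_smul, hb.1, hb.2]

lemma isNoetherian_quotient [IsNoetherian R P] (N : Submodule A P) : IsNoetherian R (P ⧸ N) :=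
  isNoetherian_of_surjective (N.mkQ.restrictScalars R) (LinearMap.range_eq_top.2 N.mkQ_surjective)

lemma isNoetherian_submodule_restrict [IsNoetherian R P] (N : Submodule A P) : IsNoetherian R N :=
  isNoetherian_of_injective (N.subtype.restrictScalars R) N.injective_subtype

lemma isArtinianRing_of_finite_quotient [Algebra ℂ R] (J : Ideal R) [Module.Finite ℂ (R ⧸ J)] :
    IsArtinianRing (R ⧸ J) :=
  IsArtinianRing.of_finite ℂ _

end Steps

lemma subsingleton_ext_of_iso {C : Type*} [Category C] [Abelian C] [HasExt.{u} C] {F X Y : C}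
    (e : X ≅ Y) {i : ℕ} (h : Subsingleton (Ext.{u} F X i)) : Subsingleton (Ext.{u} F Y i) := by
  refine subsingleton_of_forall_eq 0 fun x => ?_
  rw [← x.comp_mk₀_id, ← e.inv_hom_id, ← Ext.mk₀_comp_mk₀, ← Ext.comp_assoc_of_third_deg_zero,
    Subsingleton.elim (x.comp (Ext.mk₀ e.inv) (add_zero i)) 0, Ext.zero_comp]

/-- Let `x, y` be a regular sequence on `T`, and let `(x, y, z)` be primary to the maximal ideal
`I`. If `Ext^i(R ⧸ I, T) = 0` for `i < 3`, then `x, y, z` is a regular sequence on `T`. -/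
theorem ker_mulEnd_eq_bot_of_subsingleton_ext {R : Type u} [CommRing R] {T : Type u}
    [AddCommGroup T] [Module R T] [IsNoetherian R T] {x y z : R} {I : Ideal R}
    [IsArtinianRing (R ⧸ Ideal.span {x, y, z})]
    (hI : ∀ I' : Ideal R, I'.IsMaximal → Ideal.span {x, y, z} ≤ I' → I' = I)
    (hT : ∀ i : ℕ, i < 3 → Subsingleton (Ext (ModuleCat.of R (R ⧸ I)) (ModuleCat.of R T) i))
    (h₁ : IsRegularStep x (⊥ : Submodule R T) (mulRange₁ R T x))
    (h₂ : IsRegularStep y (mulRange₁ R T x) (mulRange₂ R T x y)) :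
    LinearMap.ker (mulEnd R (T ⧸ mulRange₂ R T x y) z) = ⊥ := by
  let X := T ⧸ mulRange₂ R T x y
  let F := LinearMap.ker (mulEnd R X z)
  have hF : IsFiniteLength R F :=
    isFiniteLength_of_smul_eq_zero fun r hr => (span_smul_eq_zero hr).1
  have hext : ∀ i : ℕ, i < 3 →
      Subsingleton (Ext (ModuleCat.of R F) (ModuleCat.of R (T ⧸ (⊥ : Submodule R T))) i) := by
    intro i hi
    refine subsingleton_ext_of_isFiniteLength (I := I) hI ?_ F hF
      fun r hr => (span_smul_eq_zero hr).1
    exact subsingleton_ext_of_iso (Submodule.quotEquivOfEqBot ⊥ rfl).symm.toModuleIso (hT i hi)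
  -- Dimension shifting: vanishing of Ext^i(F, T) for i < 3 gives vanishing on T/xT for i < 2, and
  -- then Hom(F, T/(x, y)T) = 0, so the inclusion of the kernel is zero.
  have e1 := h₁.subsingleton_ext_right (hext 1 (by omega)) (hext 2 (by omega))
  have e0 := h₁.subsingleton_ext_right (hext 0 (by omega)) (hext 1 (by omega))
  have e2 := h₂.subsingleton_ext_right e0 e1
  have hzero : ModuleCat.ofHom F.subtype = 0 :=
    (Ext.homEquiv₀ (X := ModuleCat.of R F) (Y := ModuleCat.of R X)).symm.injective
      (Subsingleton.elim _ _)
  rw [Submodule.eq_bot_iff]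
  intro q hq
  exact congrArg (fun f => f.hom ⟨q, hq⟩) hzero

variable {M : Type u} [AddCommGroup M] [Module.Free ℤ M] {k : ℕ} {v : Fin k → Module.Dual ℤ M}

section Transfer

variable {A : Type u} [Ring A] [Algebra (toricRing v) A]
  {P : Type u} [AddCommGroup P] [Module (toricRing v) P] [Module A P]
  [IsScalarTower (toricRing v) A P] {ι : Type*} {c : ι → Fin k → ℤ}
  (e : P ≃ₗ[toricRing v] ∀ i, rankOne v (c i))

include e

lemma coe_equiv_smul (r : toricRing v) (p : P) (i : ι) :
    (e (r • p) i : LaurentRing M) = r * (e p i : LaurentRing M) :=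
  congrArg (fun q => (q i : LaurentRing M)) (e.map_smul r p)

lemma coe_equiv_add (p q : P) (i : ι) :
    (e (p + q) i : LaurentRing M) = (e p i : LaurentRing M) + (e q i : LaurentRing M) :=
  congrArg (fun q => (q i : LaurentRing M)) (e.map_add p q)

lemma equiv_ext {p q : P} (h : ∀ i, (e p i : LaurentRing M) = (e q i : LaurentRing M)) : p = q :=
  e.injective (funext fun i => Subtype.ext (h i))

lemma isRegularStep₁ {x : toricRing v} (hx : x ≠ 0) :
    IsRegularStep x (⊥ : Submodule A P) (mulRange₁ A P x) := by
  refine IsRegularStep.sup_range fun p hp => ?_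
  rw [Submodule.mem_bot] at hp ⊢
  refine equiv_ext e fun i => ?_
  have := congrArg (fun q => (e q i : LaurentRing M)) hp
  simp only [coe_equiv_smul, map_zero] at this
  rw [map_zero]
  exact (mul_eq_zero.1 this).resolve_left fun h => hx (Subtype.ext h)

lemma isRegularStep₂ {x y : toricRing v}
    (hy : ∀ b, ∀ t ∈ rankOne v b, ∀ s ∈ rankOne v b, (y : LaurentRing M) * t = x * s →
        ∃ t' ∈ rankOne v b, t = x * t') :
    IsRegularStep y (mulRange₁ A P x) (mulRange₂ A P x y) := by
  refine IsRegularStep.sup_range fun p hp => ?_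
  obtain ⟨q, hq⟩ := mem_mulRange₁.1 hp
  have h1 : ∀ i, ∃ t' : rankOne v (c i), (e p i : LaurentRing M) = x * t' := fun i => by
    obtain ⟨t', ht', h⟩ := hy _ _ (e p i).2 _ (e q i).2 (by
      rw [← coe_equiv_smul, ← coe_equiv_smul, hq])
    exact ⟨⟨t', ht'⟩, h⟩
  choose t ht using h1
  refine mem_mulRange₁.2 ⟨e.symm t, equiv_ext e fun i => ?_⟩
  rw [coe_equiv_smul, e.apply_symm_apply, ht]

lemma isRegularStep₃ {x y z : toricRing v}
    (hz : ∀ b, ∀ t ∈ rankOne v b, ∀ s ∈ rankOne v b, ∀ r ∈ rankOne v b,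
        (z : LaurentRing M) * t = x * s + y * r →
        ∃ s' ∈ rankOne v b, ∃ r' ∈ rankOne v b, t = x * s' + y * r') :
    IsRegularStep z (mulRange₂ A P x y) (mulRange₃ A P x y z) := by
  refine IsRegularStep.sup_range fun p hp => ?_
  obtain ⟨q, q', hq⟩ := mem_mulRange₂.1 hp
  have h1 : ∀ i, ∃ s r : rankOne v (c i), (e p i : LaurentRing M) = x * s + y * r := fun i => by
    obtain ⟨s, hs, r, hr, h⟩ := hz _ _ (e p i).2 _ (e q i).2 _ (e q' i).2 (by
      rw [← coe_equiv_smul, ← coe_equiv_smul, ← coe_equiv_smul, ← coe_equiv_add, hq])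
    exact ⟨⟨s, hs⟩, ⟨r, hr⟩, h⟩
  choose s r hsr using h1
  refine mem_mulRange₂.2 ⟨e.symm s, e.symm r, equiv_ext e fun i => ?_⟩
  rw [coe_equiv_add, coe_equiv_smul, coe_equiv_smul, e.apply_symm_apply, e.apply_symm_apply, hsr]

/-- If `z` acts injectively on `P ⧸ (x P + y P)`, it is regular modulo `(x, y)` on each of the
summands of `P`. -/
lemma exists_combination_of_ker_eq_bot {x y z : toricRing v}
    (hker : LinearMap.ker (mulEnd A (P ⧸ mulRange₂ A P x y) z) = ⊥) (i : ι)
    {p s t : LaurentRing M} (hp : p ∈ rankOne v (c i)) (hs : s ∈ rankOne v (c i))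
    (ht : t ∈ rankOne v (c i)) (h : (z : LaurentRing M) * p = x * s + y * t) :
    ∃ s' ∈ rankOne v (c i), ∃ t' ∈ rankOne v (c i), p = x * s' + y * t' := by
  classical
  let E : rankOne v (c i) → P := fun a => e.symm (Pi.single i a)
  have hE : ∀ a, e (E a) = Pi.single i a := fun a => e.apply_symm_apply _
  have h1 : z • E ⟨p, hp⟩ = x • E ⟨s, hs⟩ + y • E ⟨t, ht⟩ := by
    refine equiv_ext e fun j => ?_
    rw [coe_equiv_smul, coe_equiv_add, coe_equiv_smul, coe_equiv_smul, hE, hE, hE]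
    by_cases hj : j = i
    · subst hj
      simpa using h
    · simp [Pi.single_eq_of_ne hj]
  have h2 : (mulRange₂ A P x y).mkQ (E ⟨p, hp⟩) ∈
      LinearMap.ker (mulEnd A (P ⧸ mulRange₂ A P x y) z) :=
    (Submodule.Quotient.mk_eq_zero _).2 (mem_mulRange₂.2 ⟨_, _, h1⟩)
  rw [hker, Submodule.mem_bot] at h2
  obtain ⟨q, q', hq⟩ := mem_mulRange₂.1 ((Submodule.Quotient.mk_eq_zero _).1 h2)
  refine ⟨_, (e q i).2, _, (e q' i).2, ?_⟩
  rw [← coe_equiv_smul, ← coe_equiv_smul, ← coe_equiv_add, ← hq, hE, Pi.single_eq_same]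

end Transfer

/-! ### Modules of covariants of a relation -/

/-- The irrelevant ideal is the only maximal ideal containing a system of parameters. -/
lemma eq_irrelevantIdeal {J I : Ideal (toricRing v)} (hI : I.IsMaximal) (hJI : J ≤ I)
    (hJ : ∀ m hm, m ≠ 0 → toricMonomial v m hm ∈ J.radical) : I = irrelevantIdeal v := by
  have hle : J.radical ≤ I := hI.isPrime.radical_le_iff.2 hJI
  have hge : irrelevantIdeal v ≤ I := by
    refine Ideal.span_le.2 ?_
    rintro f ⟨m, hm, hf⟩
    have hm' : ∀ i, 0 ≤ v i m := monomial_mem_toricRing.1 (hf ▸ f.2)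
    have : f = toricMonomial v m hm' := Subtype.ext hf
    exact this ▸ hle (hJ m hm' hm)
  refine le_antisymm (fun f hf => ?_) hge
  -- Modulo the irrelevant ideal every element equals its constant coefficient, which would be a
  -- unit in `I` if it were nonzero.
  have key : f - algebraMap ℂ (toricRing v) (coeff 0 f.1) ∈ irrelevantIdeal v := by
    classical
    have h1 : ∀ m : {m // m ∈ f.1.supp}, ∀ i, 0 ≤ v i m.1 := fun m i =>
      mem_toricRing.1 f.2 i m.1 (mem_supp.1 m.2)
    have h2 : ∀ m : {m // m ∈ f.1.supp}, m.1 ≠ 0 →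
        coeff m.1 f.1 • toricMonomial v m.1 (h1 m) ∈ irrelevantIdeal v := fun m hm => by
      rw [Algebra.smul_def]
      exact Ideal.mul_mem_left _ _ (Ideal.subset_span ⟨m.1, hm, rfl⟩)
    have h3 := eq_sum_toricMonomial f
    by_cases h0 : (0 : M) ∈ f.1.supp
    · rw [← Finset.add_sum_erase _ _ (Finset.mem_attach _ ⟨0, h0⟩)] at h3
      have h4 : coeff 0 f.1 • toricMonomial v 0 (h1 ⟨0, h0⟩) =
          algebraMap ℂ (toricRing v) (coeff 0 f.1) := by
        rw [Algebra.smul_def]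
        exact mul_one _
      rw [h4] at h3
      rw [sub_eq_iff_eq_add'.2 h3]
      exact Ideal.sum_mem _ fun m hm => h2 m fun h => Finset.ne_of_mem_erase hm (Subtype.ext h)
    · have h4 : coeff 0 f.1 = 0 := by
        by_contra h
        exact h0 (mem_supp.2 h)
      rw [h4, map_zero, sub_zero, h3]
      exact Ideal.sum_mem _ fun m _ => h2 m fun h => h0 (h ▸ m.2)
  have h0 : coeff 0 f.1 = 0 := by
    by_contra h
    have h1 : algebraMap ℂ (toricRing v) (coeff 0 f.1) ∈ I := by
      have := I.sub_mem hf (hge key)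
      rwa [sub_sub_cancel] at this
    exact hI.ne_top (Ideal.eq_top_of_isUnit_mem I h1 ((IsUnit.mk0 _ h).map _))
  rwa [h0, map_zero, sub_zero] at key

variable [Module.Finite ℤ M]

/-- The module `T(b)` of a nontrivial relation `b` between the ray generators is not
Cohen-Macaulay. -/
theorem eq_zero_of_isCohenMacaulay (hv : IsRaySystem v) (hM : Module.finrank ℤ M = 3)
    {b : Fin k → ℤ} (hb : ∑ i, b i • v i = 0)
    (hCM : IsCohenMacaulay (toricRing v) (irrelevantIdeal v) (rankOne v b)) : b = 0 := by
  by_contra hne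
  obtain ⟨x, y, z, hx, hy, hJ, hz⟩ := hv.exists_parameters hM hb hne
  obtain ⟨p, hp, ⟨s, hs, t, ht, h⟩, hcon⟩ := hz 0
  rw [map_zero, add_zero] at hp hs ht hcon
  have hdim := (hv.exists_torus_sequence hM).1
  have := hv.finiteType
  have := finite_quotient_of_monomials hJ
  have := isArtinianRing_of_finite_quotient (Ideal.span {x, y, z})
  have := hv.isNoetherian_rankOne hM b
  let e : rankOne v b ≃ₗ[toricRing v] ∀ _ : Unit, rankOne v b :=
    (LinearEquiv.funUnique Unit (toricRing v) (rankOne v b)).symm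
  refine hcon (exists_combination_of_ker_eq_bot e
    (ker_mulEnd_eq_bot_of_subsingleton_ext (fun I hI hJI => eq_irrelevantIdeal hI hJI hJ)
      (fun i hi => hCM i (lt_of_lt_of_le ?_ hdim)) (isRegularStep₁ e hx) (isRegularStep₂ e hy))
    () hp hs ht h)
  exact_mod_cast hi

end Modules

/-! ### Homologically homogeneous endomorphism rings -/

section Endomorphisms

open LaurentRing CategoryTheory CategoryTheory.Abelian

section Abstract

variable {R : Type u} [CommRing R]

variable (R) in
/-- `Hom(T, E)` as a module over `End(E)`. -/
def HomModule (T E : Type u) [AddCommGroup T] [AddCommGroup E] [Module R T] [Module R E] : Type u :=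
  T →ₗ[R] E

namespace HomModule

variable {T E : Type u} [AddCommGroup T] [AddCommGroup E] [Module R T] [Module R E]

instance instAddCommGroup : AddCommGroup (HomModule R T E) := inferInstanceAs (AddCommGroup (T →ₗ[R] E))

instance instModule : Module R (HomModule R T E) := inferInstanceAs (Module R (T →ₗ[R] E))

instance instModuleEnd : Module (Module.End R E) (HomModule R T E) :=
  inferInstanceAs (Module (Module.End R E) (T →ₗ[R] E))

instance instIsScalarTowerEnd : IsScalarTower R (Module.End R E) (HomModule R T E) where
  smul_assoc _ _ _ := LinearMap.ext fun _ => rfl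

/-- The underlying linear map of an element of `Hom(T, E)`. -/
def toHom (f : HomModule R T E) : T →ₗ[R] E := f

/-- A linear map as an element of `Hom(T, E)`. -/
def ofHom (f : T →ₗ[R] E) : HomModule R T E := f

/-- If `T` is a direct summand of `E`, then `Hom(T, E)` is a projective `End(E)`-module. -/
lemma projective_of_summand (i : T →ₗ[R] E) (π : E →ₗ[R] T) (h : π ∘ₗ i = LinearMap.id) :
    Module.Projective (Module.End R E) (HomModule R T E) := by
  let I : HomModule R T E →ₗ[Module.End R E] Module.End R E :=
    { toFun := fun f => LinearMap.comp f π
      map_add' := fun _ _ => rfl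
      map_smul' := fun _ _ => rfl }
  let S : Module.End R E →ₗ[Module.End R E] HomModule R T E :=
    { toFun := fun f => LinearMap.comp f i
      map_add' := fun _ _ => rfl
      map_smul' := fun _ _ => rfl }
  have key : ∀ f : T →ₗ[R] E, (f ∘ₗ π) ∘ₗ i = f := fun f => by
    rw [LinearMap.comp_assoc, h, LinearMap.comp_id]
  exact Module.Projective.of_split I S (LinearMap.ext fun f => key f)

end HomModule

lemma isSimpleModule_quotient {A : Type*} [Ring A] {P : Type*} [AddCommGroup P] [Module A P]
    {N : Submodule A P} (hN : ∃ p, p ∉ N) (h : ∀ p, p ∉ N → ∀ q, ∃ a : A, q - a • p ∈ N) :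
    IsSimpleModule A (P ⧸ N) := by
  rw [isSimpleModule_iff_toSpanSingleton_surjective]
  refine ⟨?_, fun s hs q => ?_⟩
  · obtain ⟨p, hp⟩ := hN
    exact ⟨N.mkQ p, 0, fun h => hp ((Submodule.Quotient.mk_eq_zero _).1 h)⟩
  · obtain ⟨p, rfl⟩ := N.mkQ_surjective s
    obtain ⟨q, rfl⟩ := N.mkQ_surjective q
    obtain ⟨a, ha⟩ := h p (fun h => hs ((Submodule.Quotient.mk_eq_zero _).2 h)) q
    exact ⟨a, ((Submodule.Quotient.eq N).2 ha).symm⟩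

/-- Let `A` be homologically homogeneous, and let some simple quotient of a projective `A`-module
`P` be cut out by a regular sequence of length three. Then a sequence `x, y, z` in `R` that
generates an ideal of finite colength is regular on `P` as soon as `x, y` is. -/
theorem ker_mulEnd_eq_bot_of_isHomologicallyHomogeneous {A : Type u} [Ring A] [Algebra R A]
    (hA : IsHomologicallyHomogeneous A) {P : Type u} [AddCommGroup P] [Module R P] [Module A P]
    [IsScalarTower R A P] [Module.Projective A P] [IsNoetherian R P] {x y z x' y' z' : R}
    [IsArtinianRing (R ⧸ Ideal.span {x, y, z})]
    (h₁ : IsRegularStep x (⊥ : Submodule A P) (mulRange₁ A P x))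
    (h₂ : IsRegularStep y (mulRange₁ A P x) (mulRange₂ A P x y))
    (h₁' : IsRegularStep x' (⊥ : Submodule A P) (mulRange₁ A P x'))
    (h₂' : IsRegularStep y' (mulRange₁ A P x') (mulRange₂ A P x' y'))
    (h₃' : IsRegularStep z' (mulRange₂ A P x' y') (mulRange₃ A P x' y' z'))
    (hS : IsSimpleModule A (P ⧸ mulRange₃ A P x' y' z')) :
    LinearMap.ker (mulEnd A (P ⧸ mulRange₂ A P x y) z) = ⊥ := by
  have hS' := projectiveDimension_of_isRegularStep h₁' h₂' h₃'
  have hproj : Module.Projective A (P ⧸ (⊥ : Submodule A P)) :=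
    Module.Projective.of_equiv (Submodule.quotEquivOfEqBot ⊥ rfl).symm
  have hP : HasProjectiveDimensionLT (ModuleCat.of A (P ⧸ (⊥ : Submodule A P))) 1 := by
    have : Projective (ModuleCat.of A (P ⧸ (⊥ : Submodule A P))) :=
      (IsProjective.iff_projective _).1 hproj
    infer_instance
  have hnt := hS.nontrivial
  -- The simple fibre has projective dimension exactly 3, and homogeneity carries this to every
  -- simple module.
  refine ker_eq_bot_of_isFiniteLength (n := 2) (fun S _ _ hS₀ => ?_)
    (h₂.hasProjectiveDimensionLT (h₁.hasProjectiveDimensionLT hP)) _ ?_ ?_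
  · have heq := hA (ModuleCat.of A S) (ModuleCat.of A (P ⧸ mulRange₃ A P x' y' z')) hS₀ hS
    rw [← projectiveDimension_lt_iff, ← projectiveDimension_lt_iff, heq,
      projectiveDimension_lt_iff, projectiveDimension_lt_iff]
    exact ⟨hS'.1, hS'.2 hnt⟩
  · have := isNoetherian_quotient (R := R) (mulRange₂ A P x y)
    have := isNoetherian_submodule_restrict (R := R)
      (LinearMap.ker (mulEnd A (P ⧸ mulRange₂ A P x y) z))
    exact isFiniteLength_of_smul_eq_zero (R := R) fun r hr => (span_smul_eq_zero hr).1
  · have := isNoetherian_quotient (R := R) (mulRange₂ A P x y)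
    have := isNoetherian_quotient (R := R)
      (LinearMap.range (mulEnd A (P ⧸ mulRange₂ A P x y) z))
    exact isFiniteLength_of_smul_eq_zero (R := R) fun r hr => (span_smul_eq_zero hr).2

end Abstract

end Endomorphisms

/-! ### Homomorphisms between the modules T(b) as columns of Laurent polynomials -/

section Columns

open LaurentRing

variable {M : Type u} [AddCommGroup M] {k : ℕ} {v : Fin k → Module.Dual ℤ M}

/-- Multiplication by `g ∈ T(b' - b)` as a map `T(b) → T(b')`. -/
def mulHom {b b' : Fin k → ℤ} (g : rankOne v (b' - b)) : rankOne v b →ₗ[toricRing v] rankOne v b' where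
  toFun s := ⟨g * s, by
    have := mul_mem_rankOne g.2 s.2
    rwa [sub_add_cancel] at this⟩
  map_add' s t := Subtype.ext (mul_add _ _ _)
  map_smul' r s := Subtype.ext (mul_left_comm (g : LaurentRing M) (r : LaurentRing M) s)

variable [Module.Free ℤ M] [Module.Finite ℤ M]

lemma IsRaySystem.exists_monomial_mem (hv : IsRaySystem v) (hM : Module.finrank ℤ M = 3)
    (b : Fin k → ℤ) : ∃ m : M, monomial m ∈ rankOne v b := by
  obtain ⟨u, hu⟩ := hv.exists_interior hM
  obtain ⟨N, hN⟩ := exists_nsmul_ge hu b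
  exact ⟨N • u, monomial_mem_rankOne.2 hN⟩

/-- The bound `b i` is attained: a multiple of a vector with `v i e = 1` fixes the value on `v i`,
and a facet point raises all the others. This makes the order of a multiplier on T(b) along `v i`
visible. -/
lemma IsRaySystem.exists_monomial_mem_eq (hv : IsRaySystem v) (b : Fin k → ℤ) (i : Fin k) :
    ∃ m : M, monomial m ∈ rankOne v b ∧ v i m = b i := by
  obtain ⟨e, he⟩ := hv.exists_eq_one i
  obtain ⟨m, hm, hpos⟩ := hv.exists_facet i
  obtain ⟨N, hN⟩ := exists_nsmul_ge (ι := {l // l ≠ i}) (w := fun l => v l) (u := m)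
    (fun l => hpos l l.2) (fun l => b l - v l (b i • e))
  have h : v i (b i • e + N • m) = b i := by simp [he, hm]
  refine ⟨b i • e + N • m, monomial_mem_rankOne.2 fun l => ?_, h⟩
  by_cases hl : l = i
  · rw [hl, h]
  · have := hN ⟨l, hl⟩
    rw [map_add]
    linarith

/-- Every homomorphism `T(b) → T(b')` is the multiplication by an element of `T(b' - b)`. -/
lemma IsRaySystem.mulHom_surjective (hv : IsRaySystem v) (hM : Module.finrank ℤ M = 3)
    {b b' : Fin k → ℤ} (f : rankOne v b →ₗ[toricRing v] rankOne v b') :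
    ∃ g : rankOne v (b' - b), f = mulHom g := by
  obtain ⟨m, hm⟩ := hv.exists_monomial_mem hM b
  obtain ⟨w, hw⟩ := hv.exists_monomial_mem hM (-b)
  -- The multiplier is read off from one monomial; linearity determines `f` after denominators are
  -- cleared by `monomial w`.
  let g : LaurentRing M := monomial (-m) * f ⟨_, hm⟩
  have hR : ∀ s : rankOne v b, monomial w * (s : LaurentRing M) ∈ toricRing v := fun s => by
    have := mul_mem_rankOne hw s.2
    rwa [neg_add_cancel, mem_rankOne_zero] at this
  have hf : ∀ s : rankOne v b, (f s : LaurentRing M) = g * s := fun s => by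
    have h1 : (⟨_, hR ⟨_, hm⟩⟩ : toricRing v) • s = (⟨_, hR s⟩ : toricRing v) • ⟨_, hm⟩ :=
      Subtype.ext (show monomial w * monomial m * (s : LaurentRing M) =
        monomial w * s * monomial m by ring)
    have h2 := congrArg f h1
    rw [map_smul, map_smul] at h2
    have h3 : monomial w * monomial m * (f s : LaurentRing M) =
        monomial w * s * f ⟨_, hm⟩ := congrArg Subtype.val h2
    refine mul_left_cancel₀ (monomial_ne_zero w) (mul_left_cancel₀ (monomial_ne_zero m) ?_)
    calc monomial m * (monomial w * (f s : LaurentRing M))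
        = monomial w * s * f ⟨_, hm⟩ := by rw [← h3]; ring
      _ = monomial w * s * ((monomial m * monomial (-m)) * f ⟨_, hm⟩) := by
        rw [monomial_mul_monomial_neg, one_mul]
      _ = monomial m * (monomial w * (g * s)) := by ring
  refine ⟨⟨g, fun n hn i => ?_⟩, LinearMap.ext fun s => Subtype.ext (hf s)⟩
  obtain ⟨l, hl, hli⟩ := hv.exists_monomial_mem_eq b i
  have h1 := (f ⟨_, hl⟩).2 (l + n) (mem_supp.2 (by
    rw [hf, mul_comm, coeff_monomial_mul, add_sub_cancel_left]
    exact mem_supp.1 hn)) i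
  rw [map_add, hli] at h1
  rw [Pi.sub_apply]
  linarith

variable {l : ℕ} (b : Fin l → Fin k → ℤ) (j : Fin l)

/-- The endomorphism ring of `⨁ T(b i)`. -/
def columnRing (v : Fin k → Module.Dual ℤ M) (b : Fin l → Fin k → ℤ) : Type u :=
  Module.End (toricRing v) (rankOneSum v b)

instance : Ring (columnRing v b) := inferInstanceAs (Ring (Module.End _ _))

instance : Algebra (toricRing v) (columnRing v b) :=
  Module.End.instAlgebra (toricRing v) (toricRing v) (rankOneSum v b)

/-- The module `Hom(T(b j), ⨁ T(b i))` over the endomorphism ring of `⨁ T(b i)`. -/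
def columnModule (v : Fin k → Module.Dual ℤ M) (b : Fin l → Fin k → ℤ) (j : Fin l) : Type u :=
  HomModule (toricRing v) (rankOne v (b j)) (rankOneSum v b)

instance : AddCommGroup (columnModule v b j) := inferInstanceAs (AddCommGroup (HomModule _ _ _))

instance : Module (toricRing v) (columnModule v b j) :=
  HomModule.instModule (R := toricRing v) (T := rankOne v (b j)) (E := rankOneSum v b)

instance : Module (columnRing v b) (columnModule v b j) :=
  HomModule.instModuleEnd (R := toricRing v) (T := rankOne v (b j)) (E := rankOneSum v b)

instance : IsScalarTower (toricRing v) (columnRing v b) (columnModule v b j) :=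
  HomModule.instIsScalarTowerEnd (R := toricRing v) (T := rankOne v (b j)) (E := rankOneSum v b)

/-- The homomorphism `T(b j) → ⨁ T(b i)` with the entries `g i ∈ T(b i - b j)`. -/
def columnHom : (∀ i, rankOne v (b i - b j)) →ₗ[toricRing v] columnModule v b j where
  toFun g := HomModule.ofHom (LinearMap.pi fun i => mulHom (g i))
  map_add' _ _ := LinearMap.ext fun _ => funext fun _ => Subtype.ext (add_mul _ _ _)
  map_smul' _ _ := LinearMap.ext fun _ => funext fun _ => Subtype.ext (mul_assoc _ _ _)

/-- The `i`-th entry of the value at `s` of an element of `Hom(T(b j), ⨁ T(b i))`. -/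
def entry (p : columnModule v b j) (s : rankOne v (b j)) (i : Fin l) : rankOne v (b i) :=
  HomModule.toHom (R := toricRing v) (T := rankOne v (b j)) (E := rankOneSum v b) p s i

/-- The endomorphism of `⨁ T(b i)` that is given on `T(b j)` by the column `g`, and is zero on the
other summands. -/
def columnEnd (g : ∀ i, rankOne v (b i - b j)) : columnRing v b :=
  (LinearMap.pi fun i => mulHom (g i) : rankOne v (b j) →ₗ[toricRing v] rankOneSum v b) ∘ₗ
    LinearMap.proj j

lemma coe_entry_columnEnd_smul {j' : Fin l} (g : ∀ i, rankOne v (b i - b j'))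
    (p : columnModule v b j) (s : rankOne v (b j)) (i : Fin l) :
    (entry b j (columnEnd b j' g • p) s i : LaurentRing M) = g i * entry b j p s j' := rfl

variable {b j} in
lemma entry_ext {p q : columnModule v b j} (h : ∀ s i, entry b j p s i = entry b j q s i) :
    p = q :=
  LinearMap.ext fun s => funext fun i => h s i

lemma coe_columnHom (g : ∀ i, rankOne v (b i - b j)) (s : rankOne v (b j)) (i : Fin l) :
    (entry b j (columnHom b j g) s i : LaurentRing M) = g i * s := rfl

lemma IsRaySystem.columnHom_bijective (hv : IsRaySystem v) (hM : Module.finrank ℤ M = 3) :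
    Function.Bijective (columnHom (v := v) b j) := by
  constructor
  · intro g h hgh
    obtain ⟨m, hm⟩ := hv.exists_monomial_mem hM (b j)
    funext i
    have h1 := congrArg (fun f => (entry b j f ⟨_, hm⟩ i : LaurentRing M)) hgh
    exact Subtype.ext (mul_right_cancel₀ (monomial_ne_zero m) h1)
  · intro f
    choose g hg using fun i => hv.mulHom_surjective hM
      (LinearMap.proj i ∘ₗ HomModule.toHom (R := toricRing v) (T := rankOne v (b j)) (E := rankOneSum v b) f)
    exact ⟨g, entry_ext fun s i => (congrArg (fun f => f s) (hg i)).symm⟩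

/-- The column of entries of a homomorphism `T(b j) → ⨁ T(b i)`. -/
def columnEquiv (hv : IsRaySystem v) (hM : Module.finrank ℤ M = 3) :
    columnModule v b j ≃ₗ[toricRing v] ∀ i, rankOne v (b i - b j) :=
  (LinearEquiv.ofBijective (columnHom b j) (hv.columnHom_bijective b j hM)).symm

lemma columnEquiv_columnHom (hv : IsRaySystem v) (hM : Module.finrank ℤ M = 3)
    (g : ∀ i, rankOne v (b i - b j)) : columnEquiv b j hv hM (columnHom b j g) = g :=
  (LinearEquiv.ofBijective (columnHom b j) (hv.columnHom_bijective b j hM)).symm_apply_apply g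

lemma columnHom_columnEquiv (hv : IsRaySystem v) (hM : Module.finrank ℤ M = 3)
    (p : columnModule v b j) : columnHom b j (columnEquiv b j hv hM p) = p :=
  (LinearEquiv.ofBijective (columnHom b j) (hv.columnHom_bijective b j hM)).apply_symm_apply p

end Columns

/-! ### Noncommutative crepant resolutions and points of the torus -/

section Resolutions

open LaurentRing

variable {M : Type u} [AddCommGroup M] [Module.Free ℤ M] [Module.Finite ℤ M] {k : ℕ}
  {v : Fin k → Module.Dual ℤ M} {l : ℕ} (b : Fin l → Fin k → ℤ) (j : Fin l)

lemma projective_columnModule :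
    Module.Projective (columnRing v b) (columnModule v b j) := by
  classical
  refine HomModule.projective_of_summand
    (LinearMap.single (toricRing v) (fun i => rankOne v (b i)) j) (LinearMap.proj j) ?_
  exact LinearMap.proj_comp_single_same _ _ _

variable (hv : IsRaySystem v) (hM : Module.finrank ℤ M = 3)

include hv hM

lemma isNoetherian_columnModule : IsNoetherian (toricRing v) (columnModule v b j) := by
  have := fun i => hv.isNoetherian_rankOne hM (b i - b j)
  exact isNoetherian_of_linearEquiv (M := ∀ i, rankOne v (b i - b j))
    (columnEquiv b j hv hM).symm

/-- The fibre of `Hom(T(b j), ⨁ T(b i))` at the unit of the torus is a simple module. -/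
lemma isSimpleModule_fibre {x y z : toricRing v} (hx : evalOne (x : LaurentRing M) = 0)
    (hy : evalOne (y : LaurentRing M) = 0) (hz : evalOne (z : LaurentRing M) = 0)
    (h : ∀ b, ∀ t ∈ rankOne v b, evalOne t = 0 → ∃ s ∈ rankOne v b, ∃ r ∈ rankOne v b,
        ∃ q ∈ rankOne v b, t = x * s + y * r + z * q) :
    IsSimpleModule (columnRing v b)
      (columnModule v b j ⧸ mulRange₃ (columnRing v b) (columnModule v b j) x y z) := by
  classical
  let e : columnModule v b j ≃ₗ[toricRing v] ∀ i, rankOne v (b i - b j) := columnEquiv b j hv hM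
  -- The submodule divided out consists of the columns that vanish at the unit of the torus.
  have hmem : ∀ p : columnModule v b j,
      p ∈ mulRange₃ (columnRing v b) (columnModule v b j) x y z ↔
        ∀ i, evalOne (e p i : LaurentRing M) = 0 := by
    intro p
    rw [mem_mulRange₃]
    constructor
    · rintro ⟨q, q', q'', rfl⟩ i
      rw [coe_equiv_add, coe_equiv_add, coe_equiv_smul, coe_equiv_smul, coe_equiv_smul]
      simp [hx, hy, hz]
    · intro hp
      have h1 : ∀ i, ∃ s r q : rankOne v (b i - b j),
          (e p i : LaurentRing M) = x * s + y * r + z * q := fun i => by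
        obtain ⟨s, hs, r, hr, q, hq, heq⟩ := h _ _ (e p i).2 (hp i)
        exact ⟨⟨s, hs⟩, ⟨r, hr⟩, ⟨q, hq⟩, heq⟩
      choose s r q hsrq using h1
      refine ⟨e.symm s, e.symm r, e.symm q, equiv_ext e fun i => ?_⟩
      rw [coe_equiv_add, coe_equiv_add, coe_equiv_smul, coe_equiv_smul, coe_equiv_smul,
        e.apply_symm_apply, e.apply_symm_apply, e.apply_symm_apply, hsrq]
  refine isSimpleModule_quotient ?_ fun p hp q => ?_
  · choose m hm using fun i => hv.exists_monomial_mem hM (b i - b j)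
    refine ⟨columnHom b j fun i => ⟨_, hm i⟩, fun h0 => ?_⟩
    have h1 := (hmem _).1 h0 j
    rw [columnEquiv_columnHom, evalOne_monomial] at h1
    exact one_ne_zero h1
  · rw [hmem, not_forall] at hp
    obtain ⟨i₀, hi₀⟩ := hp
    choose m hm using fun i => hv.exists_monomial_mem hM (b i - b i₀)
    -- Since `p` has nonzero value in entry `i₀`, scaled monomials acting on that entry produce any
    -- prescribed column of values at the unit.
    let a : ∀ i, rankOne v (b i - b i₀) := fun i =>
      ⟨(evalOne (e q i : LaurentRing M) / evalOne (e p i₀ : LaurentRing M)) • monomial (m i), by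
        have := toricRing_mul_mem_rankOne ((toricRing v).algebraMap_mem
          (evalOne (e q i : LaurentRing M) / evalOne (e p i₀ : LaurentRing M))) (hm i)
        rwa [← Algebra.smul_def] at this⟩
    refine ⟨columnEnd b i₀ a, (hmem _).2 fun i => ?_⟩
    have h1 : columnEnd b i₀ a • p = columnHom b j fun i => ⟨(a i : LaurentRing M) * (e p i₀ : LaurentRing M), by
          have := mul_mem_rankOne (a i).2 (e p i₀).2
          rwa [sub_add_sub_cancel] at this⟩ := by
      refine entry_ext fun s i => Subtype.ext ?_
      rw [coe_entry_columnEnd_smul, coe_columnHom, ← columnHom_columnEquiv b j hv hM p,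
        coe_columnHom, columnEquiv_columnHom, mul_assoc]
    have h2 : (e (q - columnEnd b i₀ a • p) i : LaurentRing M) =
        e q i - (a i : LaurentRing M) * (e p i₀ : LaurentRing M) := by
      refine (congrArg (fun f => (f i : LaurentRing M)) (map_sub e _ _)).trans ?_
      rw [h1]
      exact congrArg (fun f => (e q i - f i : LaurentRing M)) (columnEquiv_columnHom b j hv hM _)
    have h3 : evalOne (a i : LaurentRing M) =
        evalOne (e q i : LaurentRing M) / evalOne (e p i₀ : LaurentRing M) := by
      refine (map_smul evalOne _ _).trans ?_
      rw [evalOne_monomial, smul_eq_mul, mul_one]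
    rw [h2, map_sub, map_mul, h3, div_mul_cancel₀ _ hi₀, sub_self]

/-- If the endomorphism ring of `⨁ T(b i)` is homologically homogeneous, the difference of two of
the `b i` can be translated to a relation between the ray generators only trivially. -/
theorem eq_zero_of_isHomologicallyHomogeneous
    (hA : IsHomologicallyHomogeneous (Module.End (toricRing v) (rankOneSum v b))) (i : Fin l)
    {c : Fin k → ℤ} (hc : ∑ i, c i • v i = 0) {n : M} (hcn : b i - b j = c + phiT v n) : c = 0 := by
  by_contra hne
  obtain ⟨x, y, z, hx, hy, hJ, hz⟩ := hv.exists_parameters hM hc hne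
  obtain ⟨p, hp, ⟨s, hs, t, ht, h⟩, hcon⟩ := hz n
  -- The translate of T(c) is T(b i - b j), the i-th summand of the column module.
  rw [← hcn] at hp hs ht hcon
  obtain ⟨-, x', y', z', hx', hy', hz', hex, hey, hez, hev⟩ := hv.exists_torus_sequence hM
  have := hv.finiteType
  have := finite_quotient_of_monomials hJ
  have := isArtinianRing_of_finite_quotient (Ideal.span {x, y, z})
  have hA' : IsHomologicallyHomogeneous (columnRing v b) := hA
  have := projective_columnModule (v := v) b j
  have := isNoetherian_columnModule b j hv hM
  let e : columnModule v b j ≃ₗ[toricRing v] ∀ i, rankOne v (b i - b j) := columnEquiv b j hv hM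
  exact hcon (exists_combination_of_ker_eq_bot e
    (ker_mulEnd_eq_bot_of_isHomologicallyHomogeneous hA' (isRegularStep₁ e hx) (isRegularStep₂ e hy)
      (isRegularStep₁ e hx') (isRegularStep₂ e hy') (isRegularStep₃ e hz')
      (isSimpleModule_fibre b j hv hM hex hey hez hev)) i hp hs ht h)

omit hM

lemma phiPhiT_kappa (c : Fin k → ℤ) : phiPhiT v (kappa hv c) = 1 ⊗ₜ phi v c :=
  (LinearEquiv.ofBijective (phiPhiT v) (phiPhiT_bijective hv)).apply_symm_apply _

/-- If `κ̄(b) = κ̄(b')`, then `b` and `b'` differ by an element of `M` and a relation between the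
ray generators. -/
lemma exists_relation_of_kappaBar_eq {b b' : Fin k → ℤ} (h : kappaBar hv b = kappaBar hv b') :
    ∃ n : M, ∑ i, (b - b' - phiT v n) i • v i = 0 := by
  -- The two values of κ differ by a lattice point `n`; applying φφᵀ gives φ(b - b') = φφᵀ(n).
  obtain ⟨n, hn⟩ := (Submodule.Quotient.eq _).1 h
  refine ⟨n, ?_⟩
  have h1 := congrArg (phiPhiT v) hn
  rw [map_sub, phiPhiT_kappa, phiPhiT_kappa, ← TensorProduct.tmul_sub, ← map_sub] at h1
  have h2 : phi v (phiT v n) = phi v (b - b') := one_tmul_dual_injective h1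
  have h3 : phi v (b - b' - phiT v n) = 0 := by rw [map_sub, h2, sub_self]
  exact h3

end Resolutions

end ToricNCCR

end

/-! ### The theorem -/

open ToricNCCR in
theorem mainTheorem10 {M : Type u} [AddCommGroup M] [Module.Free ℤ M] [Module.Finite ℤ M]
    (hM : Module.finrank ℤ M = 3) {k : ℕ} (v : Fin k → Module.Dual ℤ M) (hv : IsRaySystem v) :
    (∀ b : Fin k → ℤ, ∑ i, b i • v i = 0 →
      IsCohenMacaulay (toricRing v) (irrelevantIdeal v) (rankOne v b) → ∀ i, b i = 0) ∧
    (∀ (l : ℕ) (b : Fin l → Fin k → ℤ),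
      IsNCCR (toricRing v) (Module.End (toricRing v) (rankOneSum v b)) →
      (∀ i j, kappaBar hv (b i) = kappaBar hv (b j) →
        Nonempty (rankOne v (b i) ≃ₗ[toricRing v] rankOne v (b j))) ∧
      ((∀ i j, i ≠ j → IsEmpty (rankOne v (b i) ≃ₗ[toricRing v] rankOne v (b j))) →
        Function.Injective fun j => kappaBar hv (b j))) := by
  have key : ∀ (l : ℕ) (b : Fin l → Fin k → ℤ),
      IsNCCR (toricRing v) (Module.End (toricRing v) (rankOneSum v b)) →
      ∀ i j, kappaBar hv (b i) = kappaBar hv (b j) →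
        Nonempty (rankOne v (b i) ≃ₗ[toricRing v] rankOne v (b j)) := by
    intro l b hA i j hij
    obtain ⟨n, hn⟩ := exists_relation_of_kappaBar_eq hv hij
    have h0 := eq_zero_of_isHomologicallyHomogeneous b j hv hM hA.2 i hn (n := n) (by abel)
    have h1 : b i = b j + phiT v n := by
      rw [← sub_eq_zero, ← h0]
      abel
    rw [h1]
    exact ⟨(rankOneShift (b j) n).symm⟩
  refine ⟨fun b hb hCM i => congrFun (eq_zero_of_isCohenMacaulay hv hM hb hCM) i,
    fun l b hA => ⟨key l b hA, fun hne i j hij => ?_⟩⟩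
  by_contra h
  exact (hne i j h).elim (key l b hA i j hij).some
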